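/- **Conventions.** For $m>0$ let $\operatorname{vol}(B^m)=\pi^{m/2}/\Gamma(\tfrac m2+1)$. Let $\mu$ be a finite Borel measure on a compact metric space $(M,d)$ (for a Riemannian manifold, $d$ is the Riemannian distance). It is *$s$-Ahlfors regular* if there are $c,C,r_0>0$ with $c\,r^s\le\mu(B(x,r))\le C\,r^s$ for all $x\in\operatorname{supp}\mu$ and $0<r\le r_0$. Put $F(r)=(\mu\times\mu)\{(x,y):d(x,y)\le r\}$. The measure *admits an averaged $s$-density* $A_\mu\in(0,\infty)$ if $F(r)=\operatorname{vol}(B^s)A_\mu r^s+o(r^s)$ as $r\to0^+$; then let $q(r)=F(r)/(\operatorname{vol}(B^s)A_\mu r^s)$, so that $q(r)\to 1$ as $r\to0^+$. Let $G(t)=\iint e^{-d(x,y)^2/(4t)}\,d\mu(x)\,d\mu(y)$, $w_s(u)=\tfrac12u^{s+1}e^{-u^2/4}$, $\gamma_s=s2^{s-1}\Gamma(\tfrac s2)\operatorname{vol}(B^s)$ and $C_{n,s}=(2\pi)^{-(n-s)}\operatorname{vol}(B^{n-s})$. On the flat torus $\mathbb T^n=\mathbb R^n/\mathbb Z^n$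 let $\{e_j\}_{j\ge0}$ be any complete orthonormal basis of $L^2(\mathbb T^n)$ of real Laplace eigenfunctions, $-\Delta e_j=\lambda_j^2e_j$, $0=\lambda_0<\lambda_1\le\lambda_2\le\cdots$, and let $N_\mu(\lambda)=\sum_{\lambda_j\le\lambda}\bigl|\int e_j\,d\mu\bigr|^2$. **Theorem.** (1) Let $n,s$ be integers with $1\le s<n$. There is no $\delta>0$ such that every finite Borel measure $\mu$ on $\mathbb T^n$ that is $s$-Ahlfors regular and admits an averaged $s$-density $A_\mu$ satisfies $$N_\mu(\lambda)=C_{n,s}A_\mu\lambda^{n-s}+O(\lambda^{n-s-\delta})\qquad(\lambda\to\infty),$$ even if the implied constant may depend on $\mu$. (2) A counterexample is explicit. Let $n,s$ be as in (1), let $a_m>0$ ($m\ge0$) with $\sum_m a_m\le\frac14$, let $\delta>0$, and let $\psi:\mathbb R\to\mathbb R$ be any function with $\psi(r)\to0$ as $r\to0^+$. Then there are thresholds $\Phi_m:\mathbb R\to\mathbb R$ ($m\ge0$) such that the following holds for all frequencies $k_m\in\mathbb Z^s\setminus\{0\}$ with $|k_0|<|k_1|<\cdots$, $|k_0|\ge\Phi_0(0)$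 and $|k_{m+1}|\ge\Phi_{m+1}(|k_m|)$ for all $m\ge0$. Put $w(x)=1+\sum_m a_m\cos(2\pi k_m\cdot x)$ and $d\mu=w\,dV_{\mathbb T^s}$ on $\mathbb T^s=\mathbb T^s\times\{0\}\subset\mathbb T^n$. Then $\mu$ is finite, $s$-Ahlfors regular, and admits the averaged $s$-density $A_\mu=\int_{\mathbb T^s}w^2\,dV_{\mathbb T^s}=1+\frac12\sum_m a_m^2$, but as $r\to0^+$, $t\to0^+$ and $\lambda\to\infty$, respectively, $$q(r)-1\ne O(\psi(r)),\qquad \frac{G(t)}{t^{s/2}}-\gamma_sA_\mu\neq O(t^{\delta/2}),\qquad N_\mu(\lambda)-C_{n,s}A_\mu\lambda^{n-s}\ne O(\lambda^{n-s-\delta}).$$ (3) For every real $s>0$ there is $c_s>0$, depending only on $s$, such that the following holds. Let $\mu$ be a finite Borel measure on a compact metric space $M$, and let $A_\mu>0$ and $C_0\ge1$ be such that $q(r)\to1$ as $r\to0^+$ and $q\le C_0$ on $(0,\operatorname{diam}M]$. Let $\eta\in(0,1)$ and $U\ge2$ satisfy $\int_U^\infty w_s\,du\le\frac{\eta}{8C_0}\int_1^Uw_s\,du$.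 Then for all sufficiently small $r>0$, $$q(\rho)\le1-\eta\ \text{ for all }\rho\in[r,Ur]\quad\Longrightarrow\quad\Bigl|\frac{G(r^2)}{r^{s}}-\gamma_sA_\mu\Bigr|\ge c_s\,A_\mu\,\eta\int_1^Uw_s(u)\,du .$$ The same implication holds for every $r>0$ (not only for small $r$) with $q\le1$ on $(0,r]$. -/

import Mathlib

open MeasureTheory Filter Topology Asymptotics
open scoped ContDiff ENNReal Laplacian

universe u

namespace Kuznecov

noncomputable section

/-! ### Measures on a metric space: Ahlfors regularity, distance distribution, densities -/

/-- The volume `π^{m/2} / Γ(m/2 + 1)` of the unit ball in formal dimension `m`. -/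
def ballVol (m : ℝ) : ℝ := Real.pi ^ (m / 2) / Real.Gamma (m / 2 + 1)

/-- `c r^s ≤ μ(B(x, r)) ≤ C r^s` for all `x ∈ supp μ` and `0 < r ≤ r₀`. -/
def IsAhlforsRegular {M : Type u} [MetricSpace M] [MeasurableSpace M]
    (μ : Measure M) (s : ℝ) : Prop :=
  ∃ c C r₀ : ℝ, 0 < c ∧ 0 < C ∧ 0 < r₀ ∧
    ∀ x ∈ μ.support, ∀ r : ℝ, 0 < r → r ≤ r₀ →
      c * r ^ s ≤ μ.real (Metric.closedBall x r) ∧ μ.real (Metric.closedBall x r) ≤ C * r ^ s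

/-- The distance distribution `F(r) = (μ × μ){(x, y) : d(x, y) ≤ r}`. -/
def distDistribution {M : Type u} [MetricSpace M] [MeasurableSpace M]
    (μ : Measure M) (r : ℝ) : ℝ :=
  (μ.prod μ).real {p : M × M | dist p.1 p.2 ≤ r}

/-- `A ∈ (0, ∞)` is the averaged `s`-density constant of `μ`:
`F(r) = vol(B^s) A r^s + o(r^s)` as `r → 0⁺`. -/
def HasAveragedDensity {M : Type u} [MetricSpace M] [MeasurableSpace M]
    (μ : Measure M) (s A : ℝ) : Prop :=
  0 < A ∧
    (fun r : ℝ => distDistribution μ r - ballVol s * A * r ^ s) =o[𝓝[>] 0] fun r : ℝ => r ^ s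

/-- The normalized distance distribution `q(r) = F(r) / (vol(B^s) A r^s)`. -/
def normDistDistribution {M : Type u} [MetricSpace M] [MeasurableSpace M]
    (μ : Measure M) (s A r : ℝ) : ℝ :=
  distDistribution μ r / (ballVol s * A * r ^ s)

/-- The Gaussian average `G(t) = ∬ exp(-d(x, y)² / (4t)) dμ(x) dμ(y)`. -/
def gaussianAverage {M : Type u} [MetricSpace M] [MeasurableSpace M]
    (μ : Measure M) (t : ℝ) : ℝ :=
  ∫ p : M × M, Real.exp (-(dist p.1 p.2) ^ 2 / (4 * t)) ∂(μ.prod μ)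

/-- The weight `w_s(u) = u^{s+1} e^{-u²/4} / 2`. -/
def gaussWeight (s u : ℝ) : ℝ := 1 / 2 * u ^ (s + 1) * Real.exp (-u ^ 2 / 4)

/-- `γ_s = s 2^{s-1} Γ(s/2) vol(B^s)`. -/
def gammaConst (s : ℝ) : ℝ := s * 2 ^ (s - 1) * Real.Gamma (s / 2) * ballVol s

/-- `C_{n,s} = (2π)^{-(n-s)} vol(B^{n-s})`. -/
def kuznecovConst (n s : ℝ) : ℝ := (2 * Real.pi) ^ (-(n - s)) * ballVol (n - s)

/-! ### The flat torus, its Laplace eigenbases and the Kuznecov sum -/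

/-- The flat torus `ℝⁿ / ℤⁿ` as a metric space; the `ℓ²`-product of the quotient distances of
`ℝ / ℤ` is the Riemannian distance `d(x, y) = min_{k ∈ ℤⁿ} |x - y + k|`. -/
abbrev FlatTorus (n : ℕ) : Type := PiLp 2 fun _ : Fin n => UnitAddCircle

/-- The normalized Haar measure of `(ℝ / ℤ)ⁿ`, that is, the Riemannian volume of the flat torus
(whose total volume is `1`), on the underlying product of circles. -/
def circleVolume (n : ℕ) : Measure (UnitAddTorus (Fin n)) :=
  Measure.pi fun _ => AddCircle.haarAddCircle

/-- The Riemannian volume measure of the flat torus. -/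
def torusVolume (n : ℕ) : Measure (FlatTorus n) :=
  (circleVolume n).map (WithLp.toLp 2)

/-- The covering map `ℝⁿ → ℝⁿ / ℤⁿ`, a local isometry. -/
def torusProj (n : ℕ) (x : EuclideanSpace ℝ (Fin n)) : FlatTorus n :=
  WithLp.toLp 2 fun i => (x i : UnitAddCircle)

/-- `e₀, e₁, …` is a complete orthonormal basis of `L²` of the flat torus consisting of real
(smooth) Laplace eigenfunctions, `-Δ e_j = λ_j² e_j` with `0 = λ₀ < λ₁ ≤ λ₂ ≤ ⋯`. Smoothness and
the Laplacian of a function on the torus are those of its periodic lift to `ℝⁿ`. -/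
structure IsLaplaceEigenbasis (n : ℕ) (e : ℕ → FlatTorus n → ℝ) (lam : ℕ → ℝ) : Prop where
  lam_zero : lam 0 = 0
  lam_one_pos : 0 < lam 1
  lam_mono : Monotone lam
  smooth : ∀ j, ContDiff ℝ ∞ (fun x => e j (torusProj n x))
  eigen : ∀ j x, -(Δ (fun y : EuclideanSpace ℝ (Fin n) => e j (torusProj n y)) x) =
    lam j ^ 2 * e j (torusProj n x)
  basis : ∃ b : HilbertBasis ℕ ℝ (Lp ℝ 2 (torusVolume n)),
    ∀ j, (b j : FlatTorus n → ℝ) =ᵐ[torusVolume n] e j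

/-- The Kuznecov sum `N_μ(Λ) = ∑_{λ_j ≤ Λ} |∫ e_j dμ|²`. -/
def kuznecovSum {n : ℕ} (e : ℕ → FlatTorus n → ℝ) (lam : ℕ → ℝ) (μ : Measure (FlatTorus n))
    (Λ : ℝ) : ℝ :=
  ∑' j : {j : ℕ // lam j ≤ Λ}, (∫ x, e j x ∂μ) ^ 2

/-- The remainder bound `N_μ(Λ) = C_{n,s} A Λ^{n-s} + O(Λ^{n-s-δ})` as `Λ → ∞`. -/
def HasPowerSaving {n : ℕ} (e : ℕ → FlatTorus n → ℝ) (lam : ℕ → ℝ) (μ : Measure (FlatTorus n))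
    (s A δ : ℝ) : Prop :=
  (fun Λ : ℝ => kuznecovSum e lam μ Λ - kuznecovConst n s * A * Λ ^ ((n : ℝ) - s))
    =O[atTop] fun Λ : ℝ => Λ ^ ((n : ℝ) - s - δ)

/-! ### Lacunary densities on the subtorus `𝕋ˢ = 𝕋ˢ × {0} ⊆ 𝕋ⁿ` -/

/-- The inclusion `x ↦ (x, 0)` of `𝕋ˢ` in `𝕋ⁿ` (meant for `s ≤ n`). -/
def subtorusIncl (s n : ℕ) (x : UnitAddTorus (Fin s)) : FlatTorus n :=
  WithLp.toLp 2 fun i => if h : (i : ℕ) < s then x ⟨i, h⟩ else 0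

/-- The Euclidean length of an integer frequency. -/
def freqNorm {s : ℕ} (k : Fin s → ℤ) : ℝ := √(∑ i, (k i : ℝ) ^ 2)

/-- `w(x) = 1 + ∑_m a_m cos(2π k_m · x)`; here `mFourier k x = exp(2π i k · x)`. -/
def lacunaryDensity {s : ℕ} (a : ℕ → ℝ) (k : ℕ → Fin s → ℤ) (x : UnitAddTorus (Fin s)) : ℝ :=
  1 + ∑' m, a m * (UnitAddTorus.mFourier (k m) x).re

/-- The measure `w dV_{𝕋ˢ}` on `𝕋ⁿ`. -/
def lacunaryMeasure {s : ℕ} (n : ℕ) (a : ℕ → ℝ) (k : ℕ → Fin s → ℤ) : Measure (FlatTorus n) :=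
  ((circleVolume s).withDensity fun x => ENNReal.ofReal (lacunaryDensity a k x)).map
    (subtorusIncl s n)

/-- `k_0, k_1, …` are nonzero frequencies of strictly increasing length, lacunary of growth at
least `Φ`: each `|k_m|` exceeds a bound that depends on `m` and on `|k_{m-1}|`. -/
def IsLacunary {s : ℕ} (Φ : ℕ → ℝ → ℝ) (k : ℕ → Fin s → ℤ) : Prop :=
  (∀ m, k m ≠ 0) ∧ StrictMono (fun m => freqNorm (k m)) ∧
    Φ 0 0 ≤ freqNorm (k 0) ∧ ∀ m, Φ (m + 1) (freqNorm (k m)) ≤ freqNorm (k (m + 1))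

end

end Kuznecov

open Kuznecov

/-! Part (3) is a layer-cake argument. Writing the Gaussian as a tail integral gives
`gaussianAverage_sub_eq`: the deviation of `G(r²)/r^s` from its limit is `vol(B^s) A ∫ w_s(u) (q(ru)
- 1) du`. If `q ≤ 1 - η` on `[r, Ur]`, the block `1 ≤ u ≤ U` contributes at most `-ηW`, with `W =
∫_1^U w_s`. The range below 1 costs at most `ηW/8`, because `q` is nearly at most 1 there, and the
tail beyond `U` costs at most `ηW/8` by the choice of `U`. Nothing can cancel the block.

For part (2), `F(r)` is the integral over the ball of radius `r` of the autocorrelation `1 + ½ ∑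
a_m² cos(2π k_m·v)` of `w` (`IsAdmissible.distDistribution_lacunaryMeasure`). It is continuous,
which gives the averaged density, and it is maximal at `v = 0` with value `A`, so `q ≤ 1` at small
scales. At scales comparable to `1/|k_m|` the `m`-th cosine is nonpositive on a fixed proportion of
the ball, so `1 - q` is at least a constant times `a_m²`
(`IsAdmissible.normDistDistribution_le_sub`). The amplitude `a_m` is fixed before `k_m`, so taking
`|k_m|` huge makes this defect beat any rate `ψ`. The mechanism of (3) passes the defect on to the
Gaussian average.

For the Kuznecov sum, take `λ = π|k_m|`. An eigenfunction of eigenvalue `λ_j²` has Fourier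
coefficients only on the sphere `2π|ξ| = λ_j`, so Bessel's inequality bounds `N_μ(2πX)` by the
Fourier mass of `μ` in the ball of radius `X` (`kuznecovSum_le`), for every eigenbasis. This mass is
at most the number of lattice points of length at most `X` in the `n - s` transverse directions
times the Fourier mass of `w` below `X`. For `X = |k_m|/2` the latter misses the frequencies `±k_m`,
hence is at most `A - a_m²/2`. The relative deficit is of order `a_m²`, far larger than `λ^{-δ}`.

Part (1) is (2) with geometric amplitudes. -/

open Kuznecov

/-! ### Gaussian averages and the distance distribution. -/

section GaussianAverage

variable {M : Type u} [MetricSpace M] [MeasurableSpace M]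

lemma ballVol_pos {s : ℝ} (hs : 0 ≤ s) : 0 < ballVol s := by
  unfold ballVol
  have := Real.Gamma_pos_of_pos (show 0 < s / 2 + 1 by linarith)
  positivity

lemma distDistribution_nonneg (μ : Measure M) (r : ℝ) : 0 ≤ distDistribution μ r :=
  measureReal_nonneg

lemma distDistribution_mono (μ : Measure M) [IsFiniteMeasure μ] : Monotone (distDistribution μ) :=
  fun _ _ h => measureReal_mono (fun _ hp => le_trans hp h)

lemma distDistribution_le (μ : Measure M) [IsFiniteMeasure μ] (r : ℝ) :
    distDistribution μ r ≤ (μ.prod μ).real Set.univ :=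
  measureReal_mono (Set.subset_univ _)

lemma distDistribution_eq_mul {s A r : ℝ} (hs : 0 ≤ s) (hA : 0 < A) (hr : 0 < r) (μ : Measure M) :
    distDistribution μ r = ballVol s * A * r ^ s * normDistDistribution μ s A r := by
  have h1 := ballVol_pos hs
  have h2 : 0 < r ^ s := Real.rpow_pos_of_pos hr s
  unfold normDistDistribution
  field_simp

lemma hasDerivAt_neg_exp_neg_sq_div_four (u : ℝ) :
    HasDerivAt (fun u : ℝ => -Real.exp (-u ^ 2 / 4)) (u / 2 * Real.exp (-u ^ 2 / 4)) u := by
  have h : HasDerivAt (fun u : ℝ => -u ^ 2 / 4) (-(2 * u) / 4) u := by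
    have := (hasDerivAt_pow 2 u).neg.div_const 4
    simpa using this
  exact h.exp.neg.congr_deriv (by ring)

lemma tendsto_neg_exp_neg_sq_div_four :
    Tendsto (fun u : ℝ => -Real.exp (-u ^ 2 / 4)) atTop (𝓝 0) := by
  have : Tendsto (fun u : ℝ => -u ^ 2 / 4) atTop atBot := by
    have h := (tendsto_pow_atTop (α := ℝ) two_ne_zero).atTop_div_const (four_pos (α := ℝ))
    refine (tendsto_neg_atTop_atBot.comp h).congr fun u => ?_
    simp [neg_div]
  simpa using (Real.tendsto_exp_atBot.comp this).neg

lemma integrableOn_Ioi_mul_exp_neg_sq {a : ℝ} (ha : 0 ≤ a) :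
    IntegrableOn (fun u : ℝ => u / 2 * Real.exp (-u ^ 2 / 4)) (Set.Ioi a) := by
  refine integrableOn_Ioi_deriv_of_nonneg' (fun x _ => hasDerivAt_neg_exp_neg_sq_div_four x)
    (fun x hx => ?_) tendsto_neg_exp_neg_sq_div_four
  have : 0 < x := lt_of_le_of_lt ha hx
  positivity

lemma integral_Ioi_mul_exp_neg_sq {a : ℝ} (ha : 0 ≤ a) :
    ∫ u in Set.Ioi a, u / 2 * Real.exp (-u ^ 2 / 4) = Real.exp (-a ^ 2 / 4) := by
  have := integral_Ioi_of_hasDerivAt_of_tendsto' (a := a)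
    (fun x _ => hasDerivAt_neg_exp_neg_sq_div_four x)
    (integrableOn_Ioi_mul_exp_neg_sq ha) tendsto_neg_exp_neg_sq_div_four
  rw [this]; ring

/-- The indicator over the fixed domain `(0, ∞)` makes the dependence on `d` suitable for Fubini.
The variable is rescaled by `r`, so that the weight does not depend on the scale. -/
lemma exp_neg_sq_div_eq_integral {d r : ℝ} (hd : 0 ≤ d) (hr : 0 < r) :
    Real.exp (-d ^ 2 / (4 * r ^ 2)) = ∫ u in Set.Ioi (0 : ℝ),
      (Set.Ici (d / r)).indicator (fun u : ℝ => u / 2 * Real.exp (-u ^ 2 / 4)) u := by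
  have h0 : 0 ≤ d / r := by positivity
  -- The two sets differ by at most an endpoint, whether `d = 0` or `d > 0`.
  have hset : (Set.Ici (d / r) ∩ Set.Ioi 0 : Set ℝ) =ᵐ[volume] Set.Ioi (d / r) := by
    rcases h0.eq_or_lt with h | h
    · rw [← h, Set.inter_eq_right.2 Set.Ioi_subset_Ici_self]
      exact ae_eq_refl _
    · have hsub : Set.Ici (d / r) ⊆ Set.Ioi 0 := fun x hx => lt_of_lt_of_le h hx
      rw [Set.inter_eq_left.2 hsub]
      exact Ioi_ae_eq_Ici.symm
  rw [integral_indicator measurableSet_Ici, Measure.restrict_restrict measurableSet_Ici,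
    setIntegral_congr_set hset, integral_Ioi_mul_exp_neg_sq h0]
  congr 1
  field_simp

lemma measurableSet_dist_le [BorelSpace M] [SecondCountableTopology M] (r : ℝ) :
    MeasurableSet {p : M × M | dist p.1 p.2 ≤ r} :=
  measurableSet_le measurable_dist measurable_const

/-- The layer-cake formula for the Gaussian average. -/
lemma gaussianAverage_sq_eq_integral [BorelSpace M] [SecondCountableTopology M]
    (μ : Measure M) [IsFiniteMeasure μ] {r : ℝ} (hr : 0 < r) :
    gaussianAverage μ (r ^ 2) =
      ∫ u in Set.Ioi (0 : ℝ), distDistribution μ (r * u) * (u / 2 * Real.exp (-u ^ 2 / 4)) := by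
  have hind : ∀ (p : M × M) (u : ℝ),
      (Set.Ici (dist p.1 p.2 / r)).indicator (fun u : ℝ => u / 2 * Real.exp (-u ^ 2 / 4)) u =
        {p : M × M | dist p.1 p.2 ≤ r * u}.indicator
          (fun _ => u / 2 * Real.exp (-u ^ 2 / 4)) p := by
    intro p u
    simp only [Set.indicator_apply, Set.mem_Ici, Set.mem_ofPred_eq, div_le_iff₀' hr]
  unfold gaussianAverage
  simp_rw [fun p : M × M => exp_neg_sq_div_eq_integral (dist_nonneg (x := p.1) (y := p.2)) hr]
  rw [integral_integral_swap]
  · refine integral_congr_ae (ae_of_all _ fun u => ?_)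
    simp only [hind]
    rw [integral_indicator_const _ (measurableSet_dist_le _)]
    rfl
  · have hS : MeasurableSet {z : (M × M) × ℝ | dist z.1.1 z.1.2 / r ≤ z.2} := by
      refine measurableSet_le ?_ measurable_snd
      exact (measurable_dist.comp measurable_fst).div_const r
    have hg : Integrable (fun z : (M × M) × ℝ => (1 : ℝ) * (z.2 / 2 * Real.exp (-z.2 ^ 2 / 4)))
        ((μ.prod μ).prod (volume.restrict (Set.Ioi 0))) :=
      (integrable_const (1 : ℝ)).mul_prod (integrableOn_Ioi_mul_exp_neg_sq le_rfl)
    have := hg.indicator hS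
    refine this.congr (ae_of_all _ fun z => ?_)
    simp [Set.indicator_apply, Function.uncurry]

lemma gaussWeight_eq {s u : ℝ} (hu : 0 < u) :
    gaussWeight s u = u ^ s * (u / 2 * Real.exp (-u ^ 2 / 4)) := by
  rw [gaussWeight, Real.rpow_add_one hu.ne']; ring

lemma gaussWeight_nonneg {s u : ℝ} (hu : 0 ≤ u) : 0 ≤ gaussWeight s u := by
  unfold gaussWeight; positivity

lemma gaussWeight_pos {s u : ℝ} (hu : 0 < u) : 0 < gaussWeight s u := by
  unfold gaussWeight; positivity

lemma continuous_gaussWeight {s : ℝ} (hs : 0 < s) : Continuous (gaussWeight s) := by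
  unfold gaussWeight
  refine (continuous_const.mul (Real.continuous_rpow_const (by linarith))).mul ?_
  fun_prop

lemma gaussWeight_eq_rpow_mul_exp {s : ℝ} :
    gaussWeight s = fun u => 1 / 2 * (u ^ (s + 1) * Real.exp (-(1 / 4) * u ^ (2 : ℝ))) := by
  funext u
  rw [gaussWeight, mul_assoc, Real.rpow_two]
  congr 3
  ring

lemma integrableOn_gaussWeight {s : ℝ} (hs : 0 < s) :
    IntegrableOn (gaussWeight s) (Set.Ioi 0) := by
  rw [gaussWeight_eq_rpow_mul_exp]
  exact (integrableOn_rpow_mul_exp_neg_mul_rpow (by linarith) (by norm_num)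
    (by norm_num)).const_mul _

/-- With `v = u²/4` the integral becomes `2^s Γ(s/2 + 1)`. This is `γ_s / vol(B^s)`, so `γ_s A` can
be absorbed by replacing `q` with `q - 1`. -/
lemma integral_gaussWeight {s : ℝ} (hs : 0 < s) :
    ∫ u in Set.Ioi 0, gaussWeight s u = s * 2 ^ (s - 1) * Real.Gamma (s / 2) := by
  rw [gaussWeight_eq_rpow_mul_exp, integral_const_mul,
    integral_rpow_mul_exp_neg_mul_rpow (by norm_num) (by linarith) (by norm_num)]
  have h1 : (s + 1 + 1) / 2 = s / 2 + 1 := by ring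
  have h2 : ((1 : ℝ) / 4) ^ (-(s + 1 + 1) / 2) = 2 ^ (s + 2) := by
    rw [show (1 : ℝ) / 4 = 2 ^ (-2 : ℝ) by norm_num [Real.rpow_neg], ← Real.rpow_mul (by norm_num)]
    congr 1; ring
  rw [h1, h2, Real.Gamma_add_one (by positivity), Real.rpow_add (by norm_num),
    Real.rpow_sub (by norm_num)]
  norm_num
  ring

lemma integral_gaussWeight_pos {s a b : ℝ} (hs : 0 < s) (ha : 0 ≤ a) (hab : a < b) :
    0 < ∫ u in a..b, gaussWeight s u :=
  intervalIntegral.intervalIntegral_pos_of_pos_on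
    ((continuous_gaussWeight hs).intervalIntegrable _ _)
    (fun _ hx => gaussWeight_pos (ha.trans_lt hx.1)) hab

/-- No bound on `q` near 0 is assumed; integrability comes from `F`, which is bounded by the total
mass, since the factor `u^s` of the weight cancels the denominator of `q`. -/
lemma integrableOn_gaussWeight_mul_normDistDistribution (μ : Measure M) [IsFiniteMeasure μ]
    {s A r : ℝ} (hs : 0 < s) (hA : 0 < A) (hr : 0 < r) :
    IntegrableOn (fun u => gaussWeight s u * normDistDistribution μ s A (r * u)) (Set.Ioi 0) := by
  have hb := ballVol_pos hs.le
  have hrs : 0 < r ^ s := Real.rpow_pos_of_pos hr s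
  have hF : IntegrableOn (fun u => distDistribution μ (r * u) *
      (u / 2 * Real.exp (-u ^ 2 / 4))) (Set.Ioi 0) := by
    refine (integrableOn_Ioi_mul_exp_neg_sq le_rfl).bdd_mul (c := (μ.prod μ).real Set.univ) ?_ ?_
    · exact ((distDistribution_mono μ).comp
        (monotone_mul_left_of_nonneg hr.le)).measurable.aestronglyMeasurable
    · refine ae_of_all _ fun u => ?_
      rw [Real.norm_of_nonneg (distDistribution_nonneg _ _)]
      exact distDistribution_le _ _
  refine IntegrableOn.congr_fun (hF.const_mul (ballVol s * A * r ^ s)⁻¹) (fun u hu => ?_)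
    measurableSet_Ioi
  have hu : 0 < u := hu
  have hus : 0 < u ^ s := Real.rpow_pos_of_pos hu s
  rw [gaussWeight_eq hu, distDistribution_eq_mul hs.le hA (mul_pos hr hu),
    Real.mul_rpow hr.le hu.le]
  field_simp

lemma integrableOn_gaussWeight_mul_sub_one (μ : Measure M) [IsFiniteMeasure μ]
    {s A r : ℝ} (hs : 0 < s) (hA : 0 < A) (hr : 0 < r) :
    IntegrableOn (fun u => gaussWeight s u * (normDistDistribution μ s A (r * u) - 1))
      (Set.Ioi 0) := by
  simp only [mul_sub, mul_one]
  exact (integrableOn_gaussWeight_mul_normDistDistribution μ hs hA hr).sub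
    (integrableOn_gaussWeight hs)

/-- The deviation of the Gaussian average from its limit, as a weighted average of `q - 1`. -/
lemma gaussianAverage_sub_eq [BorelSpace M] [SecondCountableTopology M]
    (μ : Measure M) [IsFiniteMeasure μ]
    {s A r : ℝ} (hs : 0 < s) (hA : 0 < A) (hr : 0 < r) :
    gaussianAverage μ (r ^ 2) / (r ^ 2) ^ (s / 2) - gammaConst s * A =
      ballVol s * A *
        ∫ u in Set.Ioi 0, gaussWeight s u * (normDistDistribution μ s A (r * u) - 1) := by
  have hrs : 0 < r ^ s := Real.rpow_pos_of_pos hr s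
  have h2 : (r ^ 2) ^ (s / 2) = r ^ s := by
    rw [← Real.rpow_natCast, ← Real.rpow_mul hr.le]; congr 1; push_cast; ring
  have hG : gaussianAverage μ (r ^ 2) = (ballVol s * A * r ^ s) *
      ∫ u in Set.Ioi 0, gaussWeight s u * normDistDistribution μ s A (r * u) := by
    rw [gaussianAverage_sq_eq_integral μ hr, ← integral_const_mul]
    refine setIntegral_congr_fun measurableSet_Ioi fun u hu => ?_
    have hu : 0 < u := hu
    rw [gaussWeight_eq hu, distDistribution_eq_mul hs.le hA (mul_pos hr hu),
      Real.mul_rpow hr.le hu.le]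
    ring
  simp only [mul_sub, mul_one]
  rw [integral_sub (integrableOn_gaussWeight_mul_normDistDistribution μ hs hA hr)
    (integrableOn_gaussWeight hs), hG, h2, integral_gaussWeight hs, gammaConst]
  field_simp

/-- Splitting the weighted average of `q - 1` at scales `1 ≤ U ≤ V`. -/
lemma integral_gaussWeight_mul_sub_one_le (μ : Measure M) [IsFiniteMeasure μ]
    {s A r U V ε η B : ℝ} (hs : 0 < s) (hA : 0 < A) (hr : 0 < r) (hU : 1 ≤ U) (hUV : U ≤ V)
    (h1 : ∀ ρ ∈ Set.Ioc 0 r, normDistDistribution μ s A ρ - 1 ≤ ε)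
    (h2 : ∀ ρ ∈ Set.Icc r (U * r), normDistDistribution μ s A ρ ≤ 1 - η)
    (h3 : ∀ ρ ∈ Set.Ioc (U * r) (V * r), normDistDistribution μ s A ρ ≤ 1)
    (h4 : ∀ ρ, V * r < ρ → normDistDistribution μ s A ρ - 1 ≤ B) :
    ∫ u in Set.Ioi 0, gaussWeight s u * (normDistDistribution μ s A (r * u) - 1) ≤
      ε * (∫ u in Set.Ioc 0 1, gaussWeight s u) - η * (∫ u in (1 : ℝ)..U, gaussWeight s u) +
        B * ∫ u in Set.Ioi V, gaussWeight s u := by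
  have hI := integrableOn_gaussWeight_mul_sub_one μ hs hA hr
  have hw := integrableOn_gaussWeight hs
  -- A one-sided bound on `q - 1` over a block integrates against the nonnegative weight.
  have hsub : ∀ {S : Set ℝ} {b c : ℝ}, MeasurableSet S → S ⊆ Set.Ioi b → 0 ≤ b →
      (∀ u ∈ S, normDistDistribution μ s A (r * u) - 1 ≤ c) →
      ∫ u in S, gaussWeight s u * (normDistDistribution μ s A (r * u) - 1) ≤
        c * ∫ u in S, gaussWeight s u := by
    intro S b c hS hSb hb hc
    have hS0 : S ⊆ Set.Ioi 0 := fun x hx => lt_of_le_of_lt hb (hSb hx)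
    rw [← integral_const_mul]
    refine setIntegral_mono_on (hI.mono_set hS0) ((hw.mono_set hS0).const_mul _) hS fun u hu => ?_
    rw [mul_comm]
    exact mul_le_mul_of_nonneg_right (hc u hu) (gaussWeight_nonneg (le_of_lt (hS0 hu)))
  have hsplit : ∀ {b c : ℝ}, 0 ≤ b → b ≤ c →
      ∫ u in Set.Ioi b, gaussWeight s u * (normDistDistribution μ s A (r * u) - 1) =
        (∫ u in Set.Ioc b c, gaussWeight s u * (normDistDistribution μ s A (r * u) - 1)) +
          ∫ u in Set.Ioi c, gaussWeight s u * (normDistDistribution μ s A (r * u) - 1) := by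
    intro b c hb hbc
    have hb1 : Set.Ioc b c ⊆ Set.Ioi 0 := fun x hx => hb.trans_lt hx.1
    have hb2 : Set.Ioi c ⊆ Set.Ioi 0 := fun x hx => (hb.trans hbc).trans_lt hx
    rw [← Set.Ioc_union_Ioi_eq_Ioi hbc,
      setIntegral_union (Set.Ioc_disjoint_Ioi le_rfl) measurableSet_Ioi (hI.mono_set hb1)
        (hI.mono_set hb2)]
  have hU0 : 0 ≤ U := zero_le_one.trans hU
  rw [hsplit le_rfl zero_le_one, hsplit zero_le_one hU, hsplit hU0 hUV,
    intervalIntegral.integral_of_le hU]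
  have e1 := hsub (S := Set.Ioc 0 1) (b := 0) (c := ε) measurableSet_Ioc (fun x hx => hx.1) le_rfl
    fun u hu => h1 _ ⟨mul_pos hr hu.1, mul_le_of_le_one_right hr.le hu.2⟩
  have e2 := hsub (S := Set.Ioc 1 U) (b := 1) (c := -η) measurableSet_Ioc (fun x hx => hx.1)
    zero_le_one fun u hu => by
      have := h2 (r * u) ⟨le_mul_of_one_le_right hr.le hu.1.le, by
        rw [mul_comm]; exact mul_le_mul_of_nonneg_right hu.2 hr.le⟩
      linarith
  have e3 := hsub (S := Set.Ioc U V) (b := U) (c := 0) measurableSet_Ioc (fun x hx => hx.1) hU0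
    fun u hu => sub_nonpos.2 (h3 _ ⟨by rw [mul_comm]; exact mul_lt_mul_of_pos_left hu.1 hr, by
      rw [mul_comm]; exact mul_le_mul_of_nonneg_right hu.2 hr.le⟩)
  have e4 := hsub (S := Set.Ioi V) (b := V) (c := B) measurableSet_Ioi subset_rfl (hU0.trans hUV)
    fun u hu => h4 _ (by rw [mul_comm]; exact mul_lt_mul_of_pos_left hu hr)
  linarith

end GaussianAverage

/-- Beyond the diameter `F` is constant while `r^s` grows, so `q` decreases and the bound at the
diameter persists. -/
lemma normDistDistribution_le_of_le_diam {M : Type u} [MetricSpace M] [CompactSpace M]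
    [MeasurableSpace M] (μ : Measure M) [IsFiniteMeasure μ] {s A C₀ : ℝ} (hs : 0 < s) (hA : 0 < A)
    (hq : Tendsto (normDistDistribution μ s A) (𝓝[>] 0) (𝓝 1))
    (hC : ∀ r : ℝ, 0 < r → r ≤ Metric.diam (Set.univ : Set M) → normDistDistribution μ s A r ≤ C₀)
    {ρ : ℝ} (hρ : 0 < ρ) : normDistDistribution μ s A ρ ≤ C₀ := by
  have hb := ballVol_pos hs.le
  have hbdd : Bornology.IsBounded (Set.univ : Set M) := isCompact_univ.isBounded
  set D := Metric.diam (Set.univ : Set M) with hD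
  have hF : ∀ r, D ≤ r → distDistribution μ r = (μ.prod μ).real Set.univ := by
    intro r hr
    unfold distDistribution
    congr 1
    ext p
    simpa using (Metric.dist_le_diam_of_mem hbdd (Set.mem_univ p.1) (Set.mem_univ p.2)).trans hr
  -- If the diameter were 0, `F` would be constant on `(0, ∞)`; since `q → 1` forces `F → 0`, it
  -- would vanish, and then so would `q`.
  have hD0 : 0 < D := by
    by_contra hcon
    have hDz : D ≤ 0 := not_lt.1 hcon
    have hlim : Tendsto (fun r : ℝ => ballVol s * A * r ^ s * normDistDistribution μ s A r)
        (𝓝[>] 0) (𝓝 0) := by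
      have h0 : Tendsto (fun r : ℝ => r ^ s) (𝓝[>] 0) (𝓝 0) := by
        have := (Real.continuousAt_rpow_const 0 s (Or.inr hs.le)).tendsto
        rw [Real.zero_rpow hs.ne'] at this
        exact this.mono_left nhdsWithin_le_nhds
      simpa using (h0.const_mul (ballVol s * A)).mul hq
    have hconst : (fun r : ℝ => ballVol s * A * r ^ s * normDistDistribution μ s A r) =ᶠ[𝓝[>] 0]
        fun _ => (μ.prod μ).real Set.univ := by
      filter_upwards [self_mem_nhdsWithin] with r hr
      rw [← distDistribution_eq_mul hs.le hA hr, hF r (hDz.trans (le_of_lt hr))]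
    have hz : (μ.prod μ).real Set.univ = 0 :=
      tendsto_nhds_unique tendsto_const_nhds (hlim.congr' hconst)
    have hq0 : normDistDistribution μ s A =ᶠ[𝓝[>] 0] fun _ => 0 := by
      filter_upwards [self_mem_nhdsWithin] with r hr
      rw [normDistDistribution, hF r (hDz.trans (le_of_lt hr)), hz, zero_div]
    exact zero_ne_one (tendsto_nhds_unique tendsto_const_nhds (hq.congr' hq0))
  rcases le_total ρ D with h | h
  · exact hC ρ hρ h
  · refine le_trans ?_ (hC D hD0 le_rfl)
    unfold normDistDistribution
    rw [hF ρ h, hF D le_rfl]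
    have : 0 < D ^ s := Real.rpow_pos_of_pos hD0 s
    gcongr

/-- A block of scales on which `q ≤ 1 - η` forces a deviation of the Gaussian average. -/
theorem gaussianAverage_deviation (s : ℝ) (hs : 0 < s) : ∃ c : ℝ, 0 < c ∧
      ∀ (M : Type u) [MetricSpace M] [CompactSpace M] [MeasurableSpace M] [BorelSpace M]
        (μ : Measure M) [IsFiniteMeasure μ] (A C₀ : ℝ), 0 < A → 1 ≤ C₀ →
        Tendsto (normDistDistribution μ s A) (𝓝[>] 0) (𝓝 1) →
        (∀ r : ℝ, 0 < r → r ≤ Metric.diam (Set.univ : Set M) →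
          normDistDistribution μ s A r ≤ C₀) →
        ∀ η U : ℝ, 0 < η → η < 1 → 2 ≤ U →
          ∫ u in Set.Ioi U, gaussWeight s u ≤ η / (8 * C₀) * ∫ u in (1 : ℝ)..U, gaussWeight s u →
          (∀ᶠ r : ℝ in 𝓝[>] 0,
            (∀ ρ ∈ Set.Icc r (U * r), normDistDistribution μ s A ρ ≤ 1 - η) →
              c * A * η * ∫ u in (1 : ℝ)..U, gaussWeight s u ≤
                |gaussianAverage μ (r ^ 2) / (r ^ 2) ^ (s / 2) - gammaConst s * A|) ∧
          (∀ r : ℝ, 0 < r →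
            (∀ ρ ∈ Set.Ioc 0 r, normDistDistribution μ s A ρ ≤ 1) →
            (∀ ρ ∈ Set.Icc r (U * r), normDistDistribution μ s A ρ ≤ 1 - η) →
              c * A * η * ∫ u in (1 : ℝ)..U, gaussWeight s u ≤
                |gaussianAverage μ (r ^ 2) / (r ^ 2) ^ (s / 2) - gammaConst s * A|) := by
  have hb := ballVol_pos hs.le
  -- The three ranges add up to at most `ηW/8 - ηW + ηW/8 ≤ -ηW/2`.
  refine ⟨ballVol s / 2, by positivity, ?_⟩
  intro M _ _ _ _ μ _ A C₀ hA hC₀ hq hC η U hη _ hU hUη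
  set W := ∫ u in (1 : ℝ)..U, gaussWeight s u with hW
  have hWpos : 0 < W := integral_gaussWeight_pos hs zero_le_one (by linarith)
  set V := ∫ u in Set.Ioc 0 1, gaussWeight s u with hV
  have hVpos : 0 < V := by
    rw [hV, ← intervalIntegral.integral_of_le zero_le_one]
    exact integral_gaussWeight_pos hs le_rfl zero_lt_one
  have hbound := fun ρ (hρ : 0 < ρ) => normDistDistribution_le_of_le_diam μ hs hA hq hC hρ
  have hTnn : 0 ≤ ∫ u in Set.Ioi U, gaussWeight s u :=
    setIntegral_nonneg measurableSet_Ioi fun u hu =>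
      gaussWeight_nonneg (by have : U < u := hu; linarith)
  have hTail : (C₀ - 1) * ∫ u in Set.Ioi U, gaussWeight s u ≤ η * W / 8 := by
    calc (C₀ - 1) * ∫ u in Set.Ioi U, gaussWeight s u
        ≤ C₀ * ∫ u in Set.Ioi U, gaussWeight s u := by gcongr; linarith
      _ ≤ C₀ * (η / (8 * C₀) * W) := by gcongr
      _ = η * W / 8 := by field_simp
  -- The allowance `ηW/(8V)` makes the range `u ≤ 1` cost at most `ηW/8`. It follows either from `q
  -- → 1` at small scales or from `q ≤ 1`.
  have key : ∀ r : ℝ, 0 < r →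
      (∀ ρ ∈ Set.Ioc 0 r, normDistDistribution μ s A ρ - 1 ≤ η * W / (8 * V)) →
      (∀ ρ ∈ Set.Icc r (U * r), normDistDistribution μ s A ρ ≤ 1 - η) →
      ballVol s / 2 * A * η * W ≤
        |gaussianAverage μ (r ^ 2) / (r ^ 2) ^ (s / 2) - gammaConst s * A| := by
    intro r hr h1 h2
    -- The two cut-offs coincide here, so the intermediate block is empty.
    have := integral_gaussWeight_mul_sub_one_le μ hs hA hr (by linarith) le_rfl h1 h2
      (fun ρ hρ => absurd hρ.1 (not_lt.2 hρ.2))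
      (fun ρ hρ => sub_le_sub_right (hbound ρ (lt_of_le_of_lt (by positivity) hρ)) 1)
    rw [← hV, ← hW] at this
    have e : η * W / (8 * V) * V = η * W / 8 := by field_simp
    rw [gaussianAverage_sub_eq μ hs hA hr]
    have h3 : ∫ u in Set.Ioi 0, gaussWeight s u * (normDistDistribution μ s A (r * u) - 1) ≤
        -(η * W / 2) := by
      have : 0 < η * W := by positivity
      linarith
    refine le_trans ?_ (neg_le_abs _)
    have h4 := mul_le_mul_of_nonneg_left h3 (show 0 ≤ ballVol s * A by positivity)
    linarith
  constructor
  · have hε : (0 : ℝ) < η * W / (8 * V) := by positivity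
    have hev : ∀ᶠ r : ℝ in 𝓝[>] 0, normDistDistribution μ s A r < 1 + η * W / (8 * V) :=
      hq.eventually_lt_const (by linarith)
    obtain ⟨r₀, hr₀, hsub⟩ := mem_nhdsGT_iff_exists_Ioo_subset.1 hev
    have hr₀ : 0 < r₀ := hr₀
    filter_upwards [Ioo_mem_nhdsGT hr₀] with r hr h2
    refine key r hr.1 (fun ρ hρ => ?_) h2
    have : normDistDistribution μ s A ρ < 1 + η * W / (8 * V) := hsub ⟨hρ.1, hρ.2.trans_lt hr.2⟩
    linarith
  · intro r hr h1 h2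
    refine key r hr (fun ρ hρ => ?_) h2
    have := h1 ρ hρ
    have : (0 : ℝ) < η * W / (8 * V) := by positivity
    linarith

/-! ### Small balls and exponential waves on the flat torus. -/

section TorusGeometry

open UnitAddTorus

instance isProbabilityMeasure_circleVolume (n : ℕ) : IsProbabilityMeasure (circleVolume n) := by
  unfold circleVolume; infer_instance

instance isAddHaarMeasure_circleVolume (n : ℕ) : (circleVolume n).IsAddHaarMeasure := by
  unfold circleVolume; infer_instance

/-- The covering map `ℝˢ → (ℝ / ℤ)ˢ`. -/
def torusMk {s : ℕ} (x : Fin s → ℝ) : UnitAddTorus (Fin s) := fun i => (x i : UnitAddCircle)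

/-- The flat norm on `(ℝ / ℤ)ˢ`: the distance to the origin. -/
noncomputable def flatNorm {s : ℕ} (v : UnitAddTorus (Fin s)) : ℝ := √(∑ i, ‖v i‖ ^ 2)

/-- The real part of an exponential monomial. -/
noncomputable def cosWave {s : ℕ} (k : Fin s → ℤ) (v : UnitAddTorus (Fin s)) : ℝ :=
  (mFourier k v).re

variable {s : ℕ}

lemma isOpenQuotientMap_torusMk : IsOpenQuotientMap (torusMk (s := s)) :=
  IsOpenQuotientMap.piMap fun _ => QuotientAddGroup.isOpenQuotientMap_mk

lemma torusMk_add (x y : Fin s → ℝ) : torusMk (x + y) = torusMk x + torusMk y := rfl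

lemma continuous_flatNorm : Continuous (flatNorm (s := s)) := by
  unfold flatNorm; fun_prop

lemma flatNorm_eq_norm (v : UnitAddTorus (Fin s)) :
    flatNorm v = ‖(WithLp.toLp 2 v : FlatTorus s)‖ := by
  rw [PiLp.norm_eq_of_L2]; rfl

lemma flatNorm_neg (v : UnitAddTorus (Fin s)) : flatNorm (-v) = flatNorm v := by
  simp [flatNorm]

lemma flatNorm_add_le (v w : UnitAddTorus (Fin s)) :
    flatNorm (v + w) ≤ flatNorm v + flatNorm w := by
  simp only [flatNorm_eq_norm]
  exact norm_add_le (WithLp.toLp 2 v : FlatTorus s) (WithLp.toLp 2 w)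

lemma norm_coe_unitAddCircle_le (x : ℝ) : ‖(x : UnitAddCircle)‖ ≤ |x| := by
  rw [UnitAddCircle.norm_eq]
  simpa using round_le x 0

lemma flatNorm_torusMk_le (x : EuclideanSpace ℝ (Fin s)) : flatNorm (torusMk x.ofLp) ≤ ‖x‖ := by
  rw [EuclideanSpace.norm_eq, flatNorm]
  gcongr with i
  exact norm_coe_unitAddCircle_le _

/-- Every point of the torus has a lift of minimal norm. -/
lemma exists_torusMk_eq (v : UnitAddTorus (Fin s)) :
    ∃ x : EuclideanSpace ℝ (Fin s), torusMk x.ofLp = v ∧ ‖x‖ = flatNorm v := by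
  have h : ∀ i, ∃ t : ℝ, (t : UnitAddCircle) = v i ∧ |t| = ‖v i‖ := by
    intro i
    obtain ⟨t, ht⟩ := QuotientAddGroup.mk_surjective (v i)
    refine ⟨t - round t, ?_, ?_⟩
    · rw [← ht]
      have : ((round t : ℝ) : UnitAddCircle) = 0 := by
        have := AddCircle.coe_period (1 : ℝ)
        rw [← zsmul_one, AddCircle.coe_zsmul, this, smul_zero]
      rw [AddCircle.coe_sub, this, sub_zero]
    · rw [← ht]
      exact (UnitAddCircle.norm_eq (x := t)).symm
  choose x hx hxn using h
  refine ⟨WithLp.toLp 2 x, funext hx, ?_⟩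
  rw [EuclideanSpace.norm_eq, flatNorm]
  simp [hxn]

lemma mFourier_torusMk (k : Fin s → ℤ) (x : Fin s → ℝ) :
    mFourier k (torusMk x) =
      Complex.exp (((2 * Real.pi * ∑ i, k i * x i : ℝ) : ℂ) * Complex.I) := by
  simp only [mFourier, ContinuousMap.coe_mk, torusMk, fourier_coe_apply]
  rw [← Complex.exp_sum]
  congr 1
  push_cast
  rw [Finset.mul_sum, Finset.sum_mul]
  refine Finset.sum_congr rfl fun i _ => ?_
  ring

lemma cosWave_torusMk (k : Fin s → ℤ) (x : Fin s → ℝ) :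
    cosWave k (torusMk x) = Real.cos (2 * Real.pi * ∑ i, k i * x i) := by
  rw [cosWave, mFourier_torusMk, Complex.exp_ofReal_mul_I_re]

lemma norm_mFourier_apply (k : Fin s → ℤ) (v : UnitAddTorus (Fin s)) : ‖mFourier k v‖ = 1 := by
  simp [mFourier, Circle.norm_coe]

lemma mFourier_apply_add (k : Fin s → ℤ) (v w : UnitAddTorus (Fin s)) :
    mFourier k (v + w) = mFourier k v * mFourier k w := by
  simp only [mFourier, ContinuousMap.coe_mk, Pi.add_apply, ← Finset.prod_mul_distrib]
  refine Finset.prod_congr rfl fun i _ => ?_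
  simp [fourier_apply, smul_add, AddCircle.toCircle_add]

lemma mFourier_apply_zero (k : Fin s → ℤ) : mFourier k (0 : UnitAddTorus (Fin s)) = 1 := by
  simp [mFourier]

lemma continuous_cosWave (k : Fin s → ℤ) : Continuous (cosWave k) :=
  Complex.continuous_re.comp (mFourier k).continuous

lemma abs_cosWave_le (k : Fin s → ℤ) (v : UnitAddTorus (Fin s)) : |cosWave k v| ≤ 1 :=
  (Complex.abs_re_le_norm _).trans (norm_mFourier_apply k v).le

lemma cosWave_zero (k : Fin s → ℤ) : cosWave k (0 : UnitAddTorus (Fin s)) = 1 := by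
  simp [cosWave, mFourier_apply_zero]

lemma ofReal_cosWave (k : Fin s → ℤ) (v : UnitAddTorus (Fin s)) :
    ((cosWave k v : ℝ) : ℂ) = (mFourier k v + mFourier (-k) v) / 2 := by
  rw [mFourier_neg, cosWave, Complex.re_eq_add_conj]

lemma freqNorm_eq (k : Fin s → ℤ) :
    freqNorm k = ‖(WithLp.toLp 2 fun i => (k i : ℝ) : EuclideanSpace ℝ (Fin s))‖ := by
  rw [EuclideanSpace.norm_eq, freqNorm]; simp

lemma freqNorm_sq (k : Fin s → ℤ) : freqNorm k ^ 2 = ∑ i, (k i : ℝ) ^ 2 :=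
  Real.sq_sqrt (Finset.sum_nonneg fun _ _ => sq_nonneg _)

lemma freqNorm_neg (k : Fin s → ℤ) : freqNorm (-k) = freqNorm k := by simp [freqNorm]

lemma freqNorm_pos {k : Fin s → ℤ} (hk : k ≠ 0) : 0 < freqNorm k := by
  rw [freqNorm_eq, norm_pos_iff]
  intro h
  apply hk
  funext i
  have := congrArg (fun x : EuclideanSpace ℝ (Fin s) => x.ofLp i) h
  simpa using this

/-- The point `k / (2 |k|²)`, at which the wave of frequency `k` is `-1`. -/
noncomputable def antiPoint (k : Fin s → ℤ) : EuclideanSpace ℝ (Fin s) :=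
  WithLp.toLp 2 fun i => k i / (2 * freqNorm k ^ 2)

lemma norm_antiPoint {k : Fin s → ℤ} (hk : k ≠ 0) : ‖antiPoint k‖ = 1 / (2 * freqNorm k) := by
  have h := freqNorm_pos hk
  have : antiPoint k = (1 / (2 * freqNorm k ^ 2)) •
      (WithLp.toLp 2 fun i => (k i : ℝ) : EuclideanSpace ℝ (Fin s)) := by
    ext i; simp [antiPoint]; ring
  rw [this, norm_smul, ← freqNorm_eq, Real.norm_of_nonneg (by positivity)]
  field_simp

lemma mFourier_antiPoint {k : Fin s → ℤ} (hk : k ≠ 0) :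
    mFourier k (torusMk (antiPoint k).ofLp) = -1 := by
  have h := freqNorm_pos hk
  have : (2 * Real.pi * ∑ i, k i * (antiPoint k).ofLp i : ℝ) = Real.pi := by
    have e : ∑ i, k i * (antiPoint k).ofLp i = freqNorm k ^ 2 / (2 * freqNorm k ^ 2) := by
      rw [freqNorm_sq, Finset.sum_div]
      refine Finset.sum_congr rfl fun i _ => ?_
      simp [antiPoint, freqNorm_sq]; ring
    rw [e]; field_simp
  rw [mFourier_torusMk, this, Complex.exp_pi_mul_I]

/-- Translation by `antiPoint k` changes the sign of the wave but not the integral. -/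
lemma integral_mFourier_of_ne {k : Fin s → ℤ} (hk : k ≠ 0) :
    ∫ v, mFourier k v ∂circleVolume s = 0 := by
  refine integral_eq_zero_of_add_right_eq_neg (g := torusMk (antiPoint k).ofLp) fun v => ?_
  rw [mFourier_apply_add, mFourier_antiPoint hk, mul_neg_one]

lemma integral_mFourier (k : Fin s → ℤ) :
    ∫ v, mFourier k v ∂circleVolume s = if k = 0 then 1 else 0 := by
  split_ifs with h
  · simp [h, mFourier_zero]
  · exact integral_mFourier_of_ne h

/-- The fundamental cube is centred at 0, so it contains every Euclidean ball of radius less than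
`1/2` about the origin. -/
lemma measurePreserving_torusMk :
    MeasurePreserving (torusMk (s := s))
      (volume.restrict (Set.univ.pi fun _ => Set.Ioc (-(1 / 2) : ℝ) (-(1 / 2) + 1)))
      (circleVolume s) := by
  have h : volume = (AddCircle.haarAddCircle : Measure UnitAddCircle) := by
    rw [AddCircle.volume_eq_smul_haarAddCircle]; simp
  have := measurePreserving_pi (ι := Fin s)
    (fun _ => volume.restrict (Set.Ioc (-(1 / 2) : ℝ) (-(1 / 2) + 1)))
    (fun _ => (volume : Measure UnitAddCircle)) (f := fun _ t => (t : UnitAddCircle))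
    (fun _ => AddCircle.measurePreserving_mk 1 (-(1 / 2)))
  rw [← Measure.restrict_pi_pi, h] at this
  exact this

lemma measurableSet_flatNorm_le (r : ℝ) :
    MeasurableSet {v : UnitAddTorus (Fin s) | flatNorm v ≤ r} :=
  (isClosed_le continuous_flatNorm continuous_const).measurableSet

lemma volume_real_closedBall (hs : 1 ≤ s) {r : ℝ} (h0 : 0 ≤ r) :
    volume.real (Metric.closedBall (0 : EuclideanSpace ℝ (Fin s)) r) = ballVol s * r ^ (s : ℝ) := by
  have : Nonempty (Fin s) := ⟨⟨0, hs⟩⟩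
  have hpi : √Real.pi ^ s = Real.pi ^ ((s : ℝ) / 2) := by
    rw [Real.sqrt_eq_rpow, ← Real.rpow_natCast, ← Real.rpow_mul Real.pi_pos.le]
    congr 1; ring
  have := Real.Gamma_pos_of_pos (show (0 : ℝ) < (s : ℝ) / 2 + 1 by positivity)
  rw [measureReal_def, EuclideanSpace.volume_closedBall,
    ENNReal.toReal_mul, ENNReal.toReal_pow, ENNReal.toReal_ofReal h0, Fintype.card_fin,
    ENNReal.toReal_ofReal (by positivity), ballVol, Real.rpow_natCast, hpi, mul_comm]

/-- The volume of a small ball of the flat torus. -/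
lemma circleVolume_flatNorm_le (hs : 1 ≤ s) {r : ℝ} (h0 : 0 ≤ r) (hr : r < 1 / 2) :
    (circleVolume s).real {v | flatNorm v ≤ r} = ballVol s * r ^ (s : ℝ) := by
  rw [measureReal_def, ← measurePreserving_torusMk.measure_preimage
    (measurableSet_flatNorm_le r).nullMeasurableSet, Measure.restrict_apply
    (measurePreserving_torusMk.measurable (measurableSet_flatNorm_le r))]
  -- On the cube every coordinate satisfies `|t| ≤ 1/2`, where the circle norm is `|t|`.
  have hset : torusMk ⁻¹' {v : UnitAddTorus (Fin s) | flatNorm v ≤ r} ∩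
      (Set.univ.pi fun _ => Set.Ioc (-(1 / 2) : ℝ) (-(1 / 2) + 1)) =
      WithLp.toLp 2 ⁻¹' Metric.closedBall (0 : EuclideanSpace ℝ (Fin s)) r := by
    have hn : ∀ t : ℝ, ‖(t : UnitAddCircle)‖ = |t| ↔ |t| ≤ 1 / 2 := fun t => by
      simpa using AddCircle.norm_coe_eq_abs_iff (1 : ℝ) (x := t) one_ne_zero
    ext x
    simp only [Set.mem_inter_iff, Set.mem_preimage, Set.mem_ofPred_eq, Set.mem_univ_pi, Set.mem_Ioc,
      mem_closedBall_zero_iff, EuclideanSpace.norm_eq, flatNorm, torusMk, Real.norm_eq_abs]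
    constructor
    · rintro ⟨h, hx⟩
      convert h using 5 with i
      refine ((hn _).2 (abs_le.2 ⟨(hx i).1.le, ?_⟩)).symm
      linarith [(hx i).2]
    · intro h
      have hxi : ∀ i, |x i| ≤ r := fun i => by
        refine le_trans ?_ h
        rw [← Real.sqrt_sq (abs_nonneg (x i))]
        exact Real.sqrt_le_sqrt (Finset.single_le_sum (f := fun i => |x i| ^ 2)
          (fun _ _ => sq_nonneg _) (Finset.mem_univ i))
      refine ⟨?_, fun i => ?_⟩
      · convert h using 5 with i
        exact (hn _).2 ((hxi i).trans hr.le)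
      · have := abs_le.1 (hxi i)
        constructor <;> linarith
  rw [hset, (PiLp.volume_preserving_toLp (Fin s)).measure_preimage
    Metric.isClosed_closedBall.measurableSet.nullMeasurableSet, ← measureReal_def,
    volume_real_closedBall hs h0]

/-- A wave of frequency `k` is nonpositive on a fixed proportion of every ball of radius at least
`1 / |k|`. -/
lemma circleVolume_cosWave_nonpos (hs : 1 ≤ s) {k : Fin s → ℤ} (hk : k ≠ 0) {r : ℝ}
    (hr : 1 ≤ freqNorm k * r) :
    ballVol s * (1 / (8 * freqNorm k)) ^ (s : ℝ) ≤
      (circleVolume s).real {v | flatNorm v ≤ r ∧ cosWave k v ≤ 0} := by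
  have hpos := freqNorm_pos hk
  have h1 : (1 : ℝ) ≤ freqNorm k := by
    have h2 : 0 < freqNorm k ^ 2 := by positivity
    rw [freqNorm_sq] at h2
    have h3 : (1 : ℝ) ≤ ∑ i, (k i : ℝ) ^ 2 := by
      have : (0 : ℤ) < ∑ i, k i ^ 2 := by exact_mod_cast h2
      exact_mod_cast this
    rw [freqNorm]
    exact Real.one_le_sqrt.2 h3
  have hsmall : 1 / (8 * freqNorm k) < 1 / 2 := by
    rw [div_lt_div_iff₀ (by positivity) (by norm_num)]; linarith
  -- On the ball of radius `1/(8|k|)` about 0 the phase is at most `π/4`, so the wave is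
  -- nonnegative. Shifting by `antiPoint k` reverses its sign and leaves the ball within distance
  -- `5/(8|k|) ≤ r` of 0.
  rw [← circleVolume_flatNorm_le hs (by positivity) hsmall, measureReal_def, measureReal_def,
    ← measure_preimage_add_right (circleVolume s) (torusMk (antiPoint k).ofLp)
      {v | flatNorm v ≤ r ∧ cosWave k v ≤ 0}]
  refine ENNReal.toReal_mono (measure_ne_top _ _) (measure_mono fun v hv => ?_)
  have hv : flatNorm v ≤ 1 / (8 * freqNorm k) := hv
  have hwave : 0 ≤ cosWave k v := by
    obtain ⟨x, rfl, hx⟩ := exists_torusMk_eq v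
    rw [cosWave_torusMk]
    have hcs : |∑ i, k i * x.ofLp i| ≤ freqNorm k * ‖x‖ := by
      have := abs_real_inner_le_norm x (WithLp.toLp 2 fun i => (k i : ℝ) : EuclideanSpace ℝ (Fin s))
      rw [← freqNorm_eq, mul_comm] at this
      simpa [PiLp.inner_apply] using this
    have hb : |∑ i, k i * x.ofLp i| ≤ 1 / 8 := by
      refine hcs.trans ?_
      rw [hx]
      calc freqNorm k * flatNorm (torusMk x.ofLp) ≤ freqNorm k * (1 / (8 * freqNorm k)) := by gcongr
        _ = 1 / 8 := by field_simp
    have hb' := abs_le.1 hb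
    have := Real.pi_pos
    refine Real.cos_nonneg_of_neg_pi_div_two_le_of_le ?_ ?_ <;> nlinarith
  refine ⟨(flatNorm_add_le _ _).trans ?_, ?_⟩
  · have h2 := flatNorm_torusMk_le (antiPoint k)
    rw [norm_antiPoint hk] at h2
    have h3 : 1 / (8 * freqNorm k) + 1 / (2 * freqNorm k) ≤ 1 / freqNorm k := by
      rw [show 1 / (8 * freqNorm k) + 1 / (2 * freqNorm k) = (5 / 8) * (1 / freqNorm k) by
        field_simp; norm_num]
      have : 0 < 1 / freqNorm k := by positivity
      linarith
    have h4 : 1 / freqNorm k ≤ r := by rwa [div_le_iff₀' hpos]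
    linarith
  · unfold cosWave at hwave ⊢
    rw [mFourier_apply_add, mFourier_antiPoint hk]
    simpa using hwave

end TorusGeometry

/-! ### Lacunary densities and their autocorrelation. -/

section LacunaryDensity

open UnitAddTorus

variable {s : ℕ} {a : ℕ → ℝ} {k : ℕ → Fin s → ℤ}

lemma integrable_circleVolume {E : Type*} [NormedAddCommGroup E] {f : UnitAddTorus (Fin s) → E}
    (hf : Continuous f) : Integrable f (circleVolume s) :=
  (integrableOn_univ (f := f)).1 (hf.continuousOn.integrableOn_compact isCompact_univ)

lemma summable_mul_cosWave (hs : Summable a) (ha : ∀ m, 0 ≤ a m) (v : UnitAddTorus (Fin s)) :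
    Summable fun m => a m * cosWave (k m) v := by
  refine Summable.of_norm_bounded hs fun m => ?_
  rw [Real.norm_eq_abs, abs_mul, abs_of_nonneg (ha m)]
  exact mul_le_of_le_one_right (ha m) (abs_cosWave_le _ _)

lemma continuous_tsum_mul_cosWave (hs : Summable a) (ha : ∀ m, 0 ≤ a m) :
    Continuous fun v : UnitAddTorus (Fin s) => ∑' m, a m * cosWave (k m) v := by
  refine continuous_tsum (fun m => continuous_const.mul (continuous_cosWave _)) hs fun m v => ?_
  rw [Real.norm_eq_abs, abs_mul, abs_of_nonneg (ha m)]
  exact mul_le_of_le_one_right (ha m) (abs_cosWave_le _ _)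

lemma lacunaryDensity_eq (v : UnitAddTorus (Fin s)) :
    lacunaryDensity a k v = 1 + ∑' m, a m * cosWave (k m) v := rfl

lemma continuous_lacunaryDensity (hs : Summable a) (ha : ∀ m, 0 ≤ a m) :
    Continuous (lacunaryDensity a k) :=
  continuous_const.add (continuous_tsum_mul_cosWave hs ha)

lemma abs_lacunaryDensity_sub_one_le (hs : Summable a) (ha : ∀ m, 0 ≤ a m) (h4 : ∑' m, a m ≤ 1 / 4)
    (v : UnitAddTorus (Fin s)) : |lacunaryDensity a k v - 1| ≤ 1 / 4 := by
  rw [lacunaryDensity_eq, add_sub_cancel_left, ← Real.norm_eq_abs]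
  refine (tsum_of_norm_bounded hs.hasSum fun m => ?_).trans h4
  rw [Real.norm_eq_abs, abs_mul, abs_of_nonneg (ha m)]
  exact mul_le_of_le_one_right (ha m) (abs_cosWave_le _ _)

lemma integral_cosWave {j : Fin s → ℤ} (hj : j ≠ 0) : ∫ v, cosWave j v ∂circleVolume s = 0 := by
  have h := integral_re (integrable_circleVolume (mFourier j).continuous)
  rw [integral_mFourier_of_ne hj] at h
  exact h

/-- Termwise integration against a lacunary density. -/
lemma hasSum_integral_lacunaryDensity_smul {E : Type*} [NormedAddCommGroup E] [NormedSpace ℝ E]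
    [CompleteSpace E] (hs : Summable a) (ha : ∀ m, 0 ≤ a m)
    {g : UnitAddTorus (Fin s) → E} (hg : Continuous g) :
    HasSum (fun m => a m • ∫ v, cosWave (k m) v • g v ∂circleVolume s)
      (∫ v, lacunaryDensity a k v • g v ∂circleVolume s - ∫ v, g v ∂circleVolume s) := by
  have hint := fun m => integrable_circleVolume ((continuous_cosWave (k m)).smul hg)
  have h1 : HasSum (fun m => ∫ v, a m • cosWave (k m) v • g v ∂circleVolume s)
      (∫ v, ∑' m, a m • cosWave (k m) v • g v ∂circleVolume s) := by
    refine hasSum_integral_of_summable_integral_norm (fun m => (hint m).smul (a m)) ?_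
    refine Summable.of_nonneg_of_le (fun m => integral_nonneg fun _ => norm_nonneg _) (fun m => ?_)
      (hs.mul_right (∫ v, ‖g v‖ ∂circleVolume s))
    rw [← integral_const_mul]
    refine integral_mono ((hint m).smul (a m)).norm
      ((integrable_circleVolume hg).norm.const_mul _) fun v => ?_
    dsimp only
    rw [norm_smul, norm_smul, Real.norm_of_nonneg (ha m), Real.norm_eq_abs]
    exact mul_le_mul_of_nonneg_left
      (mul_le_of_le_one_left (norm_nonneg _) (abs_cosWave_le _ _)) (ha m)
  simp only [integral_smul] at h1
  convert h1 using 1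
  have hWg : Integrable (fun v => lacunaryDensity a k v • g v) (circleVolume s) :=
    integrable_circleVolume ((continuous_lacunaryDensity hs ha).smul hg)
  rw [← integral_sub hWg (integrable_circleVolume hg)]
  refine integral_congr_ae (ae_of_all _ fun v => ?_)
  dsimp only
  rw [lacunaryDensity_eq, add_smul, one_smul, add_sub_cancel_left,
    ← (summable_mul_cosWave hs ha v).tsum_smul_const]
  simp only [mul_smul]

/-- Distinct lengths exclude `k_m = ±k_j`, which is all that orthogonality of the real waves
requires. -/
lemma freqNorm_injective_signs (hmono : StrictMono fun m => freqNorm (k m)) {m j : ℕ} (h : m ≠ j) :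
    k m + k j ≠ 0 ∧ k m - k j ≠ 0 := by
  constructor <;> intro h0 <;> apply h <;> apply hmono.injective <;> dsimp only
  · rw [eq_neg_of_add_eq_zero_left h0, freqNorm_neg]
  · rw [sub_eq_zero.1 h0]

lemma add_self_ne_zero_freq {j : Fin s → ℤ} (hj : j ≠ 0) : j + j ≠ 0 := by
  intro h
  apply hj
  funext i
  have := congrFun h i
  simp only [Pi.add_apply, Pi.zero_apply] at this ⊢
  omega

lemma cosWave_mul_cosWave (i j : Fin s → ℤ) (v w : UnitAddTorus (Fin s)) :
    cosWave i v * cosWave j w =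
      ((mFourier i v * mFourier j w).re + (mFourier i v * mFourier (-j) w).re) / 2 := by
  rw [mFourier_neg]
  simp [cosWave]

/-- Product-to-sum: the exponentials of frequency `i + j` and `i - j` integrate to 0 unless the
frequency vanishes. -/
lemma integral_cosWave_mul_cosWave (i j : Fin s → ℤ) (v : UnitAddTorus (Fin s)) :
    ∫ y, cosWave i y * cosWave j (y - v) ∂circleVolume s =
      (((mFourier j (-v)) * (if i + j = 0 then 1 else 0)).re +
        ((mFourier j v) * (if i - j = 0 then 1 else 0)).re) / 2 := by
  have hc : ∀ l : Fin s → ℤ, ∫ y, (mFourier i y * mFourier l (y - v)).re ∂circleVolume s =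
      (mFourier l (-v) * (if i + l = 0 then 1 else 0)).re := by
    intro l
    have e : ∀ y, mFourier i y * mFourier l (y - v) = mFourier l (-v) * mFourier (i + l) y := by
      intro y
      rw [sub_eq_add_neg, mFourier_apply_add, mFourier_add]; ring
    simp only [e]
    have h := integral_re ((integrable_circleVolume (mFourier (i + l)).continuous).const_mul
      (mFourier l (-v)))
    rw [integral_const_mul, integral_mFourier] at h
    exact h
  have hcont : ∀ l : Fin s → ℤ, Continuous fun y => (mFourier i y * mFourier l (y - v)).re := by
    intro l
    refine Complex.continuous_re.comp ((mFourier i).continuous.mul ?_)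
    exact (mFourier l).continuous.comp (continuous_id.sub continuous_const)
  simp only [cosWave_mul_cosWave]
  rw [integral_div, integral_add (integrable_circleVolume (hcont _))
    (integrable_circleVolume (hcont _)), hc, hc]
  have : mFourier (-j) (-v) = mFourier j v := by
    have h1 : mFourier (-j) (-v) * mFourier (-j) v = 1 := by
      rw [← mFourier_apply_add, neg_add_cancel, mFourier_apply_zero]
    have h2 : mFourier j v * mFourier (-j) v = 1 := by
      rw [← mFourier_add, add_neg_cancel, mFourier_zero]; rfl
    have h3 : mFourier (-j) v ≠ 0 := right_ne_zero_of_mul_eq_one h2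
    exact mul_right_cancel₀ h3 (h1.trans h2.symm)
  rw [this, ← sub_eq_add_neg]

/-- The autocorrelation of a lacunary density. -/
noncomputable def lacunaryCorr (a : ℕ → ℝ) (k : ℕ → Fin s → ℤ) (v : UnitAddTorus (Fin s)) : ℝ :=
  1 + (∑' m, a m ^ 2 * cosWave (k m) v) / 2

lemma summable_sq_of_summable (hs : Summable a) (ha : ∀ m, 0 ≤ a m) :
    Summable fun m => a m ^ 2 := by
  refine Summable.of_nonneg_of_le (fun m => sq_nonneg _) (fun m => ?_) (hs.mul_left (∑' j, a j))
  rw [sq]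
  exact mul_le_mul_of_nonneg_right (hs.le_tsum m fun j _ => ha j) (ha m)

lemma integral_lacunaryDensity (hs : Summable a) (ha : ∀ m, 0 ≤ a m) (hk : ∀ m, k m ≠ 0) :
    ∫ v, lacunaryDensity a k v ∂circleVolume s = 1 := by
  have h := hasSum_integral_lacunaryDensity_smul (k := k) hs ha (continuous_const (y := (1 : ℝ)))
  simp only [smul_eq_mul, mul_one, integral_cosWave (hk _), mul_zero, integral_const,
    probReal_univ] at h
  have := h.unique hasSum_zero
  linarith

/-- The constant and all the other waves are orthogonal to the `j`-th one; the factor `1/2` is the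
mean square of a cosine. -/
lemma integral_cosWave_mul_lacunaryDensity (hs : Summable a) (ha : ∀ m, 0 ≤ a m)
    (hk : ∀ m, k m ≠ 0) (hmono : StrictMono fun m => freqNorm (k m)) (j : ℕ)
    (v : UnitAddTorus (Fin s)) :
    ∫ y, lacunaryDensity a k y * cosWave (k j) (y - v) ∂circleVolume s =
      a j * cosWave (k j) v / 2 := by
  have hg : Continuous fun y => cosWave (k j) (y - v) :=
    (continuous_cosWave _).comp (continuous_id.sub continuous_const)
  have h := hasSum_integral_lacunaryDensity_smul (k := k) hs ha hg
  have h0 : ∫ y, cosWave (k j) (y - v) ∂circleVolume s = 0 := by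
    rw [integral_sub_right_eq_self (fun y => cosWave (k j) y) v, integral_cosWave (hk j)]
  simp only [smul_eq_mul, integral_cosWave_mul_cosWave, h0, sub_zero] at h
  refine h.unique ?_
  convert hasSum_single j ?_ using 1
  · rw [if_neg (add_self_ne_zero_freq (hk j)), sub_self, if_pos rfl]
    simp [cosWave]
    ring
  · intro m hm
    rw [if_neg (freqNorm_injective_signs hmono hm).1, if_neg (freqNorm_injective_signs hmono hm).2]
    simp

/-- One factor is expanded in waves. Translation moves the shift onto the wave, which then selects
the same frequency in the other factor; hence the squares `a_m²`. -/
lemma integral_lacunaryDensity_mul_translate (hs : Summable a) (ha : ∀ m, 0 ≤ a m)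
    (hk : ∀ m, k m ≠ 0) (hmono : StrictMono fun m => freqNorm (k m)) (v : UnitAddTorus (Fin s)) :
    ∫ y, lacunaryDensity a k y * lacunaryDensity a k (y + v) ∂circleVolume s =
      lacunaryCorr a k v := by
  have hW := continuous_lacunaryDensity (k := k) hs ha
  have hg : Continuous fun y => lacunaryDensity a k (y + v) :=
    hW.comp (continuous_id.add continuous_const)
  have h := hasSum_integral_lacunaryDensity_smul (k := k) hs ha hg
  have h0 : ∫ y, lacunaryDensity a k (y + v) ∂circleVolume s = 1 := by
    rw [integral_add_right_eq_self (fun y => lacunaryDensity a k y) v,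
      integral_lacunaryDensity hs ha hk]
  have h1 : ∀ m, ∫ y, cosWave (k m) y * lacunaryDensity a k (y + v) ∂circleVolume s =
      a m * cosWave (k m) v / 2 := by
    intro m
    rw [← integral_cosWave_mul_lacunaryDensity hs ha hk hmono,
      ← integral_add_right_eq_self (fun y => lacunaryDensity a k y * cosWave (k m) (y - v)) v]
    simp only [add_sub_cancel_right, mul_comm]
  simp only [smul_eq_mul, h0, h1] at h
  have h2 := h.tsum_eq
  rw [lacunaryCorr, ← tsum_div_const]
  have : ∀ m, a m ^ 2 * cosWave (k m) v / 2 = a m * (a m * cosWave (k m) v / 2) := fun m => by ring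
  simp only [this]
  linarith

lemma lacunaryCorr_zero : lacunaryCorr a k 0 = 1 + (∑' m, a m ^ 2) / 2 := by
  simp [lacunaryCorr, cosWave_zero]

lemma integral_sq_lacunaryDensity (hs : Summable a) (ha : ∀ m, 0 ≤ a m)
    (hk : ∀ m, k m ≠ 0) (hmono : StrictMono fun m => freqNorm (k m)) :
    ∫ y, lacunaryDensity a k y ^ 2 ∂circleVolume s = 1 + (∑' m, a m ^ 2) / 2 := by
  rw [← lacunaryCorr_zero (k := k), ← integral_lacunaryDensity_mul_translate hs ha hk hmono]
  simp [sq]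

lemma continuous_lacunaryCorr (hs : Summable a) (ha : ∀ m, 0 ≤ a m) :
    Continuous (lacunaryCorr a k) :=
  continuous_const.add ((continuous_tsum_mul_cosWave (summable_sq_of_summable hs ha)
    fun _ => sq_nonneg _).div_const 2)

/-- The autocorrelation is at most its value at the origin, minus the defect of any single wave. -/
lemma lacunaryCorr_le (hs : Summable a) (ha : ∀ m, 0 ≤ a m) (m : ℕ) (v : UnitAddTorus (Fin s)) :
    lacunaryCorr a k v ≤ lacunaryCorr a k 0 - a m ^ 2 / 2 * (1 - cosWave (k m) v) := by
  have hs2 := summable_sq_of_summable hs ha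
  have hsw := summable_mul_cosWave (k := k) hs2 (fun m => sq_nonneg _) v
  have h1 : a m ^ 2 * (1 - cosWave (k m) v) ≤ ∑' j, (a j ^ 2 - a j ^ 2 * cosWave (k j) v) := by
    rw [mul_sub, mul_one]
    refine (hs2.sub hsw).le_tsum m fun j _ => ?_
    have := (abs_le.1 (abs_cosWave_le (k j) v)).2
    nlinarith [sq_nonneg (a j)]
  rw [(hs2.tsum_sub hsw)] at h1
  rw [lacunaryCorr_zero, lacunaryCorr]
  linarith

end LacunaryDensity

/-! ### The lacunary measure: regularity, density and defects of `q`. -/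

section LacunaryMeasure

open UnitAddTorus

variable {s n : ℕ} {a : ℕ → ℝ} {k : ℕ → Fin s → ℤ}

lemma continuous_subtorusIncl : Continuous (subtorusIncl s n) := by
  unfold subtorusIncl
  refine (PiLp.continuous_toLp 2 _).comp (continuous_pi fun i => ?_)
  split_ifs
  · exact continuous_apply _
  · exact continuous_const

lemma dist_subtorusIncl (h : s ≤ n) (x y : UnitAddTorus (Fin s)) :
    dist (subtorusIncl s n x) (subtorusIncl s n y) = flatNorm (x - y) := by
  obtain ⟨d, rfl⟩ := Nat.exists_eq_add_of_le h
  rw [PiLp.dist_eq_of_L2, Fin.sum_univ_add]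
  simp [subtorusIncl, flatNorm, dist_eq_norm]

/-- The absolutely continuous measure `w dV` on the subtorus itself. -/
noncomputable def lacunaryBase (a : ℕ → ℝ) (k : ℕ → Fin s → ℤ) :
    Measure (UnitAddTorus (Fin s)) :=
  (circleVolume s).withDensity fun x => ENNReal.ofReal (lacunaryDensity a k x)

lemma lacunaryMeasure_eq : lacunaryMeasure n a k = (lacunaryBase a k).map (subtorusIncl s n) := rfl

/-- Nonnegative summable coefficients of total size at most `1/4`. -/
structure IsAdmissible (a : ℕ → ℝ) : Prop where
  summable : Summable a
  nonneg : ∀ m, 0 ≤ a m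
  tsum_le : ∑' m, a m ≤ 1 / 4

variable (ha : IsAdmissible a)
include ha

lemma IsAdmissible.continuous_density : Continuous (lacunaryDensity a k) :=
  continuous_lacunaryDensity ha.summable ha.nonneg

lemma IsAdmissible.density_mem (v : UnitAddTorus (Fin s)) :
    3 / 4 ≤ lacunaryDensity a k v ∧ lacunaryDensity a k v ≤ 5 / 4 := by
  have := abs_le.1 (abs_lacunaryDensity_sub_one_le (k := k) ha.summable ha.nonneg ha.tsum_le v)
  constructor <;> linarith

lemma IsAdmissible.density_nonneg (v : UnitAddTorus (Fin s)) : 0 ≤ lacunaryDensity a k v := by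
  linarith [(ha.density_mem (k := k) v).1]

lemma IsAdmissible.measurable_ofReal_density :
    Measurable fun x : UnitAddTorus (Fin s) => ENNReal.ofReal (lacunaryDensity a k x) :=
  ha.continuous_density.measurable.ennreal_ofReal

lemma IsAdmissible.lacunaryBase_apply {S : Set (UnitAddTorus (Fin s))} (hS : MeasurableSet S) :
    lacunaryBase a k S = ENNReal.ofReal (∫ v in S, lacunaryDensity a k v ∂circleVolume s) := by
  rw [lacunaryBase, withDensity_apply _ hS, ofReal_integral_eq_lintegral_ofReal
    (integrable_circleVolume ha.continuous_density).integrableOn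
    (ae_of_all _ ha.density_nonneg)]

lemma IsAdmissible.isFiniteMeasure_lacunaryBase : IsFiniteMeasure (lacunaryBase a k) :=
  ⟨by rw [ha.lacunaryBase_apply MeasurableSet.univ]; exact ENNReal.ofReal_lt_top⟩

lemma IsAdmissible.isFiniteMeasure_lacunaryMeasure : IsFiniteMeasure (lacunaryMeasure n a k) := by
  have := ha.isFiniteMeasure_lacunaryBase (k := k)
  rw [lacunaryMeasure_eq]; infer_instance

lemma IsAdmissible.integral_lacunaryMeasure {E : Type*} [NormedAddCommGroup E] [NormedSpace ℝ E]
    {f : FlatTorus n → E} (hf : AEStronglyMeasurable f (lacunaryMeasure n a k)) :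
    ∫ x, f x ∂lacunaryMeasure n a k =
      ∫ v, lacunaryDensity a k v • f (subtorusIncl s n v) ∂circleVolume s := by
  rw [lacunaryMeasure_eq] at hf ⊢
  rw [integral_map continuous_subtorusIncl.aemeasurable hf, lacunaryBase,
    integral_withDensity_eq_integral_toReal_smul ha.measurable_ofReal_density
      (ae_of_all _ fun _ => ENNReal.ofReal_lt_top)]
  simp only [ENNReal.toReal_ofReal (ha.density_nonneg _)]

/-- The distance distribution is the integral of the autocorrelation over balls. -/
lemma IsAdmissible.distDistribution_lacunaryMeasure (hsn : s ≤ n)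
    (hk : ∀ m, k m ≠ 0) (hmono : StrictMono fun m => freqNorm (k m)) (r : ℝ) :
    distDistribution (lacunaryMeasure n a k) r =
      ∫ v in {v | flatNorm v ≤ r}, lacunaryCorr a k v ∂circleVolume s := by
  have := ha.isFiniteMeasure_lacunaryBase (k := k)
  set ν := circleVolume s with hν
  set W := lacunaryDensity a k with hWdef
  have hW : Continuous W := ha.continuous_density
  have hWnn : ∀ v, 0 ≤ W v := ha.density_nonneg
  have hB := measurableSet_flatNorm_le (s := s) r
  have hcorr : ∀ v, ∫⁻ y, ENNReal.ofReal (W y * W (y + v)) ∂ν =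
      ENNReal.ofReal (lacunaryCorr a k v) := by
    intro v
    rw [← integral_lacunaryDensity_mul_translate ha.summable ha.nonneg hk hmono,
      ofReal_integral_eq_lintegral_ofReal]
    · exact integrable_circleVolume (hW.mul (hW.comp (continuous_id.add continuous_const)))
    · exact ae_of_all _ fun y => mul_nonneg (hWnn _) (hWnn _)
  have hcnn : ∀ v, 0 ≤ lacunaryCorr a k v := fun v => by
    rw [← integral_lacunaryDensity_mul_translate ha.summable ha.nonneg hk hmono]
    exact integral_nonneg fun y => mul_nonneg (hWnn _) (hWnn _)
  have hcint : IntegrableOn (lacunaryCorr a k) {v | flatNorm v ≤ r} ν :=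
    (integrable_circleVolume (continuous_lacunaryCorr ha.summable ha.nonneg)).integrableOn
  have hS : MeasurableSet {p : FlatTorus n × FlatTorus n | dist p.1 p.2 ≤ r} :=
    measurableSet_dist_le r
  have hS' : MeasurableSet {p : UnitAddTorus (Fin s) × UnitAddTorus (Fin s) |
      flatNorm (p.2 - p.1) ≤ r} :=
    measurableSet_le (continuous_flatNorm.comp
      (continuous_snd.sub continuous_fst)).measurable measurable_const
  have hpair : Measurable fun p : UnitAddTorus (Fin s) × UnitAddTorus (Fin s) =>
      ENNReal.ofReal (W p.1 * W p.2) :=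
    ((hW.comp continuous_fst).mul (hW.comp continuous_snd)).measurable.ennreal_ofReal
  unfold distDistribution
  rw [lacunaryMeasure_eq, Measure.map_prod_map _ _ continuous_subtorusIncl.measurable
    continuous_subtorusIncl.measurable, measureReal_def, Measure.map_apply
    (continuous_subtorusIncl.measurable.prodMap continuous_subtorusIncl.measurable) hS]
  have hpre : Prod.map (subtorusIncl s n) (subtorusIncl s n) ⁻¹'
      {p : FlatTorus n × FlatTorus n | dist p.1 p.2 ≤ r} = {p | flatNorm (p.2 - p.1) ≤ r} := by
    ext p
    simp [dist_subtorusIncl hsn, ← flatNorm_neg (p.1 - p.2)]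
  rw [hpre, lacunaryBase, prod_withDensity ha.measurable_ofReal_density
    ha.measurable_ofReal_density, withDensity_apply _ hS']
  simp only [← ENNReal.ofReal_mul (ha.density_nonneg _)]
  -- The shear `(y, v) ↦ (y, y + v)` preserves the product measure and turns the set of close pairs
  -- into a product; the inner integral in `y` is then the autocorrelation at `v`.
  rw [← (measurePreserving_prod_add ν ν).setLIntegral_comp_preimage hS' hpair]
  have hpre2 : (fun z : UnitAddTorus (Fin s) × UnitAddTorus (Fin s) => (z.1, z.1 + z.2)) ⁻¹'
      {p | flatNorm (p.2 - p.1) ≤ r} = Set.univ ×ˢ {v | flatNorm v ≤ r} := by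
    ext p; simp
  have hmeas : Measurable fun p : UnitAddTorus (Fin s) × UnitAddTorus (Fin s) =>
      ENNReal.ofReal (W p.1 * W (p.1 + p.2)) :=
    ((hW.comp continuous_fst).mul
      (hW.comp (continuous_fst.add continuous_snd))).measurable.ennreal_ofReal
  rw [hpre2, ← Measure.prod_restrict, Measure.restrict_univ, lintegral_prod_symm _
    hmeas.aemeasurable]
  simp only [hcorr]
  rw [← ofReal_integral_eq_lintegral_ofReal hcint (ae_of_all _ hcnn),
    ENNReal.toReal_ofReal (setIntegral_nonneg hB fun v _ => hcnn v)]

/-- The density lies between `3/4` and `5/4`, the inclusion is isometric, and small balls of the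
subtorus have Euclidean volume. -/
lemma IsAdmissible.isAhlforsRegular (hs : 1 ≤ s) (hsn : s ≤ n) :
    IsAhlforsRegular (lacunaryMeasure n a k) (s : ℝ) := by
  have hb := ballVol_pos (s := (s : ℝ)) (by positivity)
  refine ⟨3 / 4 * ballVol s, 5 / 4 * ballVol s, 1 / 4, by positivity, by positivity, by norm_num,
    fun x hx r hr hr4 => ?_⟩
  -- The subtorus is compact, hence closed, and carries the whole mass, so it contains the support.
  obtain ⟨y, rfl⟩ : x ∈ Set.range (subtorusIncl s n) := by
    have hcl : IsClosed (Set.range (subtorusIncl s n)) :=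
      (isCompact_range continuous_subtorusIncl).isClosed
    refine Measure.support_subset_of_isClosed hcl ?_ hx
    rw [mem_ae_iff, lacunaryMeasure_eq,
      Measure.map_apply continuous_subtorusIncl.measurable hcl.measurableSet.compl]
    simp [Set.preimage_compl]
  have hpre : subtorusIncl s n ⁻¹' Metric.closedBall (subtorusIncl s n y) r =
      (· - y) ⁻¹' {v | flatNorm v ≤ r} := by
    ext v; simp [dist_subtorusIncl hsn]
  have hmeas : MeasurableSet ((· - y) ⁻¹' {v | flatNorm v ≤ r}) :=
    (measurable_id.sub_const y) (measurableSet_flatNorm_le r)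
  have hvol : (circleVolume s).real ((· - y) ⁻¹' {v | flatNorm v ≤ r}) =
      ballVol s * r ^ (s : ℝ) := by
    rw [← circleVolume_flatNorm_le hs hr.le (by linarith), measureReal_def, measureReal_def]
    simp only [sub_eq_add_neg]
    rw [measure_preimage_add_right]
  have hWi := (integrable_circleVolume (ha.continuous_density (k := k))).integrableOn
    (s := (· - y) ⁻¹' {v | flatNorm v ≤ r})
  rw [measureReal_def, lacunaryMeasure_eq, Measure.map_apply continuous_subtorusIncl.measurable
    Metric.isClosed_closedBall.measurableSet, hpre, ha.lacunaryBase_apply hmeas,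
    ENNReal.toReal_ofReal (setIntegral_nonneg hmeas fun v _ => ha.density_nonneg v),
    mul_assoc, mul_assoc, ← hvol]
  constructor
  · rw [mul_comm, ← smul_eq_mul, ← setIntegral_const]
    exact setIntegral_mono_on (integrable_const _).integrableOn hWi hmeas
      fun v _ => (ha.density_mem v).1
  · rw [mul_comm, ← smul_eq_mul, ← setIntegral_const]
    exact setIntegral_mono_on hWi (integrable_const _).integrableOn hmeas
      fun v _ => (ha.density_mem v).2

lemma IsAdmissible.corr_zero_mem : 1 ≤ lacunaryCorr a k 0 ∧ lacunaryCorr a k 0 ≤ 2 := by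
  rw [lacunaryCorr_zero]
  have h0 : 0 ≤ ∑' m, a m ^ 2 := tsum_nonneg fun m => sq_nonneg _
  have h1 : ∑' m, a m ^ 2 ≤ ∑' m, a m := by
    refine (summable_sq_of_summable ha.summable ha.nonneg).tsum_le_tsum (fun m => ?_) ha.summable
    have := ha.summable.le_tsum m fun j _ => ha.nonneg j
    nlinarith [ha.nonneg m, ha.tsum_le]
  constructor <;> linarith [ha.tsum_le]

/-- The distance distribution falls short of `A` times the volume of balls. -/
lemma IsAdmissible.distDistribution_le (hsn : s ≤ n)
    (hk : ∀ m, k m ≠ 0) (hmono : StrictMono fun m => freqNorm (k m)) (r : ℝ) (m : ℕ) :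
    distDistribution (lacunaryMeasure n a k) r ≤
      lacunaryCorr a k 0 * (circleVolume s).real {v | flatNorm v ≤ r} -
        a m ^ 2 / 2 * (circleVolume s).real {v | flatNorm v ≤ r ∧ cosWave (k m) v ≤ 0} := by
  set S := {v : UnitAddTorus (Fin s) | flatNorm v ≤ r ∧ cosWave (k m) v ≤ 0} with hSdef
  have hB := measurableSet_flatNorm_le (s := s) r
  have hS : MeasurableSet S :=
    hB.inter (isClosed_le (continuous_cosWave (k m)) continuous_const).measurableSet
  have hpt : ∀ v, lacunaryCorr a k v ≤
      lacunaryCorr a k 0 - S.indicator (fun _ => a m ^ 2 / 2) v := by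
    intro v
    have h1 := lacunaryCorr_le (k := k) ha.summable ha.nonneg m v
    have h2 := (abs_le.1 (abs_cosWave_le (k m) v)).2
    have h3 := sq_nonneg (a m)
    by_cases hv : v ∈ S
    · rw [Set.indicator_of_mem hv]
      have : cosWave (k m) v ≤ 0 := hv.2
      nlinarith
    · rw [Set.indicator_of_notMem hv]
      nlinarith
  have hi1 : Integrable (fun _ => lacunaryCorr a k 0) ((circleVolume s).restrict
    {v | flatNorm v ≤ r}) := integrable_const _
  have hi2 : Integrable (S.indicator fun _ => a m ^ 2 / 2) ((circleVolume s).restrict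
    {v | flatNorm v ≤ r}) := (integrable_const _).indicator hS
  rw [ha.distDistribution_lacunaryMeasure hsn hk hmono]
  refine (setIntegral_mono (integrable_circleVolume (continuous_lacunaryCorr ha.summable
    ha.nonneg)).integrableOn (hi1.sub hi2) hpt).trans (le_of_eq ?_)
  simp only [Pi.sub_apply]
  rw [integral_sub hi1 hi2, setIntegral_const, setIntegral_indicator hS, setIntegral_const,
    smul_eq_mul, smul_eq_mul, mul_comm, Set.inter_eq_right.2 (fun v hv => hv.1), mul_comm (_ / 2)]

/-- `F(r)` divided by the volume of the ball is the mean of the autocorrelation over a shrinking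
ball, so it tends to the value at 0 by continuity. -/
lemma IsAdmissible.hasAveragedDensity (hs : 1 ≤ s) (hsn : s ≤ n)
    (hk : ∀ m, k m ≠ 0) (hmono : StrictMono fun m => freqNorm (k m)) :
    HasAveragedDensity (lacunaryMeasure n a k) (s : ℝ) (lacunaryCorr a k 0) := by
  have hb := ballVol_pos (s := (s : ℝ)) (by positivity)
  refine ⟨by linarith [(ha.corr_zero_mem (k := k)).1], ?_⟩
  rw [isLittleO_iff]
  intro c hc
  have hcont := continuous_lacunaryCorr (k := k) ha.summable ha.nonneg
  have hnhds : ∀ᶠ r : ℝ in 𝓝[>] 0, ∀ v : UnitAddTorus (Fin s), flatNorm v ≤ r →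
      |lacunaryCorr a k v - lacunaryCorr a k 0| ≤ c / ballVol s := by
    have h1 : ∀ᶠ x : FlatTorus s in 𝓝 0,
        |lacunaryCorr a k (WithLp.ofLp x) - lacunaryCorr a k 0| < c / ballVol s := by
      have h2 : Continuous fun x : FlatTorus s =>
          |lacunaryCorr a k (WithLp.ofLp x) - lacunaryCorr a k 0| :=
        ((hcont.comp (PiLp.continuous_ofLp 2 _)).sub continuous_const).abs
      refine (h2.tendsto 0).eventually_lt_const ?_
      simpa using by positivity
    obtain ⟨ε, hε, hball⟩ := Metric.eventually_nhds_iff.1 h1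
    filter_upwards [Ioo_mem_nhdsGT hε] with r hr v hv
    refine le_of_lt (hball (y := WithLp.toLp 2 v) ?_)
    rw [dist_zero_right, ← flatNorm_eq_norm]
    exact hv.trans_lt hr.2
  filter_upwards [hnhds, Ioo_mem_nhdsGT (show (0 : ℝ) < 1 / 2 by norm_num)] with r hr hr2
  have hvol := circleVolume_flatNorm_le hs hr2.1.le hr2.2
  have hrs : 0 ≤ r ^ (s : ℝ) := Real.rpow_nonneg hr2.1.le _
  have e : ballVol s * lacunaryCorr a k 0 * r ^ (s : ℝ) =
      ∫ v in {v | flatNorm v ≤ r}, lacunaryCorr a k 0 ∂circleVolume s := by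
    rw [setIntegral_const, hvol, smul_eq_mul]; ring
  rw [ha.distDistribution_lacunaryMeasure hsn hk hmono, e, ← integral_sub
    (integrable_circleVolume hcont).integrableOn (integrable_const _)]
  refine (norm_setIntegral_le_of_norm_le_const (s := {v | flatNorm v ≤ r})
    (measure_lt_top _ _) fun v hv => hr v hv).trans ?_
  rw [hvol, Real.norm_of_nonneg hrs]
  exact le_of_eq (by field_simp)

/-- Dividing by `A ≤ 2` turns the coefficient `a_m²/2` of the defect into `a_m²/4`. -/
lemma IsAdmissible.normDistDistribution_le (hs : 1 ≤ s) (hsn : s ≤ n)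
    (hk : ∀ m, k m ≠ 0) (hmono : StrictMono fun m => freqNorm (k m)) {r : ℝ} (hr : 0 < r)
    (hr2 : r < 1 / 2) (m : ℕ) :
    normDistDistribution (lacunaryMeasure n a k) s (lacunaryCorr a k 0) r ≤ 1 - a m ^ 2 / 4 *
      ((circleVolume s).real {v | flatNorm v ≤ r ∧ cosWave (k m) v ≤ 0} /
        (ballVol s * r ^ (s : ℝ))) := by
  have hb := ballVol_pos (s := (s : ℝ)) (by positivity)
  have hrs : 0 < r ^ (s : ℝ) := Real.rpow_pos_of_pos hr _
  obtain ⟨hA1, hA2⟩ := ha.corr_zero_mem (k := k)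
  have h := ha.distDistribution_le hsn hk hmono r m
  rw [circleVolume_flatNorm_le hs hr.le hr2] at h
  set X := (circleVolume s).real {v | flatNorm v ≤ r ∧ cosWave (k m) v ≤ 0}
  have hX : 0 ≤ X := measureReal_nonneg
  rw [normDistDistribution, div_le_iff₀ (by positivity)]
  have e : (1 - a m ^ 2 / 4 * (X / (ballVol s * r ^ (s : ℝ)))) *
      (ballVol s * lacunaryCorr a k 0 * r ^ (s : ℝ)) =
      lacunaryCorr a k 0 * (ballVol s * r ^ (s : ℝ)) - a m ^ 2 / 4 * lacunaryCorr a k 0 * X := by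
    field_simp
  rw [e]
  have : 0 ≤ a m ^ 2 * X := by positivity
  nlinarith

lemma IsAdmissible.normDistDistribution_le_one (hs : 1 ≤ s) (hsn : s ≤ n)
    (hk : ∀ m, k m ≠ 0) (hmono : StrictMono fun m => freqNorm (k m)) {r : ℝ} (hr : 0 < r)
    (hr2 : r < 1 / 2) :
    normDistDistribution (lacunaryMeasure n a k) s (lacunaryCorr a k 0) r ≤ 1 := by
  have hb := ballVol_pos (s := (s : ℝ)) (by positivity)
  have hrs : 0 < r ^ (s : ℝ) := Real.rpow_pos_of_pos hr _
  refine (ha.normDistDistribution_le hs hsn hk hmono hr hr2 0).trans (sub_le_self _ ?_)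
  positivity

/-- The wave is nonpositive on a set at least as large as a ball of radius `1/(8|k_m|) ≥ r/16`. The
block of scales `[1/|k_m|, 2/|k_m|]` fits the value `U = 2` in the Gaussian estimate. -/
lemma IsAdmissible.normDistDistribution_le_sub (hs : 1 ≤ s) (hsn : s ≤ n)
    (hk : ∀ m, k m ≠ 0) (hmono : StrictMono fun m => freqNorm (k m)) {r : ℝ} (m : ℕ)
    (hr1 : 1 ≤ freqNorm (k m) * r) (hr2 : freqNorm (k m) * r ≤ 2) (hr3 : r < 1 / 2) :
    normDistDistribution (lacunaryMeasure n a k) s (lacunaryCorr a k 0) r ≤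
      1 - a m ^ 2 / 4 * (1 / 16) ^ (s : ℝ) := by
  have hb := ballVol_pos (s := (s : ℝ)) (by positivity)
  have hf := freqNorm_pos (hk m)
  have hr : 0 < r := pos_of_mul_pos_right (zero_lt_one.trans_le hr1) hf.le
  have hrs : 0 < r ^ (s : ℝ) := Real.rpow_pos_of_pos hr _
  refine (ha.normDistDistribution_le hs hsn hk hmono hr hr3 m).trans ?_
  gcongr
  rw [le_div_iff₀ (by positivity)]
  refine le_trans ?_ (circleVolume_cosWave_nonpos hs (hk m) hr1)
  rw [mul_left_comm, ← Real.mul_rpow (by norm_num) hr.le]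
  gcongr
  rw [le_div_iff₀ (by positivity)]
  linarith

/-- At large scales the formula for the volume of balls fails, and a crude bound is enough against
the Gaussian tail: `F ≤ 1`, `A ≥ 1` and `r^{-s} ≤ 3^s`. -/
lemma IsAdmissible.normDistDistribution_le_const
    (hk : ∀ m, k m ≠ 0) {r : ℝ} (hr : 1 / 3 < r) :
    normDistDistribution (lacunaryMeasure n a k) s (lacunaryCorr a k 0) r ≤
      3 ^ (s : ℝ) / ballVol s := by
  have hb := ballVol_pos (s := (s : ℝ)) (by positivity)
  have := ha.isFiniteMeasure_lacunaryMeasure (n := n) (k := k)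
  have hr0 : 0 < r := by linarith
  have hrs : 0 < r ^ (s : ℝ) := Real.rpow_pos_of_pos hr0 _
  obtain ⟨hA1, -⟩ := ha.corr_zero_mem (k := k)
  have huniv : (lacunaryMeasure n a k).real Set.univ = 1 := by
    rw [measureReal_def, lacunaryMeasure_eq, Measure.map_apply continuous_subtorusIncl.measurable
      MeasurableSet.univ, Set.preimage_univ, ha.lacunaryBase_apply MeasurableSet.univ,
      Measure.restrict_univ, integral_lacunaryDensity ha.summable ha.nonneg hk]
    simp
  have h1 : distDistribution (lacunaryMeasure n a k) r ≤ 1 := by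
    refine (_root_.distDistribution_le _ r).trans (le_of_eq ?_)
    rw [← Set.univ_prod_univ, measureReal_prod_prod, huniv, one_mul]
  rw [normDistDistribution, div_le_div_iff₀ (by positivity) hb]
  have h3 : 1 ≤ 3 ^ (s : ℝ) * r ^ (s : ℝ) := by
    rw [← Real.mul_rpow (by norm_num) hr0.le]
    exact Real.one_le_rpow (by linarith) (by positivity)
  calc distDistribution (lacunaryMeasure n a k) r * ballVol s ≤ 1 * ballVol s := by gcongr
    _ ≤ (3 ^ (s : ℝ) * r ^ (s : ℝ)) * (ballVol s * lacunaryCorr a k 0) := by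
        gcongr; nlinarith
    _ = _ := by ring

/-- The Gaussian average at the scale `1 / |k_m|` falls short of its limit. -/
lemma IsAdmissible.gaussianAverage_le (hs : 1 ≤ s) (hsn : s ≤ n)
    (hk : ∀ m, k m ≠ 0) (hmono : StrictMono fun m => freqNorm (k m)) (m : ℕ)
    (hf : 6 ≤ freqNorm (k m)) :
    gaussianAverage (lacunaryMeasure n a k) ((1 / freqNorm (k m)) ^ 2) /
        ((1 / freqNorm (k m)) ^ 2) ^ ((s : ℝ) / 2) - gammaConst s * lacunaryCorr a k 0 ≤
      ballVol s * lacunaryCorr a k 0 *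
        (-(a m ^ 2 / 4 * (1 / 16) ^ (s : ℝ) * ∫ u in (1 : ℝ)..2, gaussWeight s u) +
          3 ^ (s : ℝ) / ballVol s * ∫ u in Set.Ioi (freqNorm (k m) / 3), gaussWeight s u) := by
  have := ha.isFiniteMeasure_lacunaryMeasure (n := n) (k := k)
  have hs0 : (0 : ℝ) < s := by positivity
  have hb := ballVol_pos hs0.le
  obtain ⟨hA1, -⟩ := ha.corr_zero_mem (k := k)
  have hA : 0 < lacunaryCorr a k 0 := by linarith
  have hf0 : 0 < freqNorm (k m) := by linarith
  have hr : 0 < 1 / freqNorm (k m) := by positivity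
  have hr6 : 1 / freqNorm (k m) ≤ 1 / 6 := by gcongr
  rw [gaussianAverage_sub_eq _ hs0 hA hr]
  refine mul_le_mul_of_nonneg_left ?_ (by positivity)
  have hV : freqNorm (k m) / 3 * (1 / freqNorm (k m)) = 1 / 3 := by field_simp
  -- With `V = |k_m|/3` the scale `V r` equals `1/3 < 1/2`, so `q ≤ 1` holds up to it and only the
  -- far tail is charged. The condition `U ≤ V` is `|k_m| ≥ 6`.
  have h := integral_gaussWeight_mul_sub_one_le (lacunaryMeasure n a k) hs0 hA hr
    (U := 2) (V := freqNorm (k m) / 3) (ε := 0) (η := a m ^ 2 / 4 * (1 / 16) ^ (s : ℝ))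
    (B := 3 ^ (s : ℝ) / ballVol s) (by norm_num) (by linarith)
    (fun ρ hρ => sub_nonpos.2 (ha.normDistDistribution_le_one hs hsn hk hmono hρ.1
      (by linarith [hρ.2])))
    (fun ρ hρ => ha.normDistDistribution_le_sub hs hsn hk hmono m
      (by have := hρ.1; rwa [div_le_iff₀' hf0] at this)
      (by have := hρ.2; rw [mul_one_div, le_div_iff₀' hf0] at this; exact this)
      (by linarith [hρ.2]))
    (fun ρ hρ => ha.normDistDistribution_le_one hs hsn hk hmono
      (lt_trans (by positivity) hρ.1) (by linarith [hρ.2]))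
    (fun ρ hρ => by
      have := ha.normDistDistribution_le_const (n := n) hk (hV ▸ hρ)
      linarith)
  linarith

end LacunaryMeasure

/-! ### Fourier support of eigenfunctions and the bound on the Kuznecov sum. -/

section TorusFourier

open UnitAddTorus

variable {n : ℕ}

/-- The Fourier coefficient of a real function on the torus. -/
noncomputable def realFourierCoeff (f : UnitAddTorus (Fin n) → ℝ) (ξ : Fin n → ℤ) : ℂ :=
  ∫ v, mFourier (-ξ) v • (f v : ℂ) ∂circleVolume n

/-- The periodic lift of a function on the torus. -/
def torusLift (f : UnitAddTorus (Fin n) → ℝ) (x : EuclideanSpace ℝ (Fin n)) : ℝ :=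
  f (torusMk x.ofLp)

/-- The directional derivative of a function on the torus. -/
noncomputable def torusDeriv (u : Fin n → ℝ) (f : UnitAddTorus (Fin n) → ℝ)
    (v : UnitAddTorus (Fin n)) : ℝ :=
  deriv (fun t : ℝ => f (v + torusMk (t • u))) 0

lemma continuous_of_torusLift {f : UnitAddTorus (Fin n) → ℝ} (hf : Continuous (torusLift f)) :
    Continuous f := by
  rw [isOpenQuotientMap_torusMk.isQuotientMap.continuous_iff]
  exact hf.comp (PiLp.continuous_toLp 2 _)

/-- Translating the base point along the line reduces time `t` to time 0, where the derivative is
`torusDeriv` by definition. -/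
lemma hasDerivAt_torus {f : UnitAddTorus (Fin n) → ℝ} (hf : ContDiff ℝ ∞ (torusLift f))
    (u : Fin n → ℝ) (v : UnitAddTorus (Fin n)) (t : ℝ) :
    HasDerivAt (fun t : ℝ => f (v + torusMk (t • u))) (torusDeriv u f (v + torusMk (t • u))) t := by
  have h : ∀ (w : UnitAddTorus (Fin n)) (t : ℝ),
      DifferentiableAt ℝ (fun t : ℝ => f (w + torusMk (t • u))) t := by
    intro w t
    obtain ⟨x, rfl, -⟩ := exists_torusMk_eq w
    have e : (fun t : ℝ => f (torusMk x.ofLp + torusMk (t • u))) =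
        fun t : ℝ => torusLift f (x + t • WithLp.toLp 2 u) := by
      funext t; simp [torusLift, torusMk_add]
    rw [e]
    exact ((hf.differentiable (by simp)).comp (by fun_prop)).differentiableAt
  have hadd : ∀ t' : ℝ, v + torusMk (t' • u) = v + torusMk (t • u) + torusMk ((t' - t) • u) := by
    intro t'
    rw [add_assoc, ← torusMk_add, ← add_smul, add_sub_cancel]
  have h0 : HasDerivAt (fun t' : ℝ => f (v + torusMk (t • u) + torusMk (t' • u)))
      (torusDeriv u f (v + torusMk (t • u))) (t - t) := by
    rw [sub_self]
    exact (h (v + torusMk (t • u)) 0).hasDerivAt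
  refine (h0.comp_sub_const t t).congr_of_eventuallyEq (Eventually.of_forall fun t' => ?_)
  simp only [← hadd]

lemma torusLift_torusDeriv {f : UnitAddTorus (Fin n) → ℝ} (hf : ContDiff ℝ ∞ (torusLift f))
    (u : Fin n → ℝ) :
    torusLift (torusDeriv u f) = fun x => fderiv ℝ (torusLift f) x (WithLp.toLp 2 u) := by
  funext x
  have h := ((hf.differentiable (by simp)) x).hasFDerivAt.hasLineDerivAt (WithLp.toLp 2 u)
  rw [HasLineDerivAt] at h
  rw [← h.deriv]
  simp only [torusLift, torusDeriv, WithLp.ofLp_add, WithLp.ofLp_smul, torusMk_add]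

lemma contDiff_torusLift_torusDeriv {f : UnitAddTorus (Fin n) → ℝ}
    (hf : ContDiff ℝ ∞ (torusLift f)) (u : Fin n → ℝ) :
    ContDiff ℝ ∞ (torusLift (torusDeriv u f)) := by
  rw [torusLift_torusDeriv hf]
  exact (hf.fderiv_right (m := ∞) (by simp)).clm_apply contDiff_const

/-- Differentiation multiplies Fourier coefficients by the symbol. -/
lemma realFourierCoeff_torusDeriv {f : UnitAddTorus (Fin n) → ℝ}
    (hf : ContDiff ℝ ∞ (torusLift f)) (u : Fin n → ℝ) (ξ : Fin n → ℤ) :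
    realFourierCoeff (torusDeriv u f) ξ =
      ((2 * Real.pi * ∑ i, ξ i * u i : ℝ) : ℂ) * Complex.I * realFourierCoeff f ξ := by
  have hfc : Continuous f := continuous_of_torusLift hf.continuous
  have hdc : Continuous (torusDeriv u f) :=
    continuous_of_torusLift (contDiff_torusLift_torusDeriv hf u).continuous
  obtain ⟨C, hC⟩ := isCompact_univ.exists_bound_of_continuousOn hdc.continuousOn
  have hshift : ∀ t : ℝ, Continuous fun v : UnitAddTorus (Fin n) => v + torusMk (t • u) :=
    fun t => continuous_id.add continuous_const
  -- The Fourier coefficient of the translate `f(· + tu)` is differentiated at `t = 0` in two ways: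
  -- here under the integral, and below through translation invariance, which makes it an explicit
  -- exponential in `t`.
  have hd := (hasDerivAt_integral_of_dominated_loc_of_deriv_le (μ := circleVolume n)
    (F := fun (t : ℝ) v => mFourier (-ξ) v • (f (v + torusMk (t • u)) : ℂ))
    (F' := fun (t : ℝ) v => mFourier (-ξ) v • (torusDeriv u f (v + torusMk (t • u)) : ℂ))
    (x₀ := 0) (s := Set.univ) (bound := fun _ => C) univ_mem
    (Eventually.of_forall fun t => ((mFourier (-ξ)).continuous.smul
      (Complex.continuous_ofReal.comp (hfc.comp (hshift t)))).aestronglyMeasurable)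
    (integrable_circleVolume ((mFourier (-ξ)).continuous.smul
      (Complex.continuous_ofReal.comp (hfc.comp (hshift 0)))))
    ((mFourier (-ξ)).continuous.smul
      (Complex.continuous_ofReal.comp (hdc.comp (hshift 0)))).aestronglyMeasurable
    (ae_of_all _ fun v t _ => by
      rw [norm_smul, norm_mFourier_apply, one_mul, Complex.norm_real]
      exact hC _ (Set.mem_univ _))
    (integrable_const _)
    (ae_of_all _ fun v t _ => by
      simpa only [smul_eq_mul] using (hasDerivAt_torus hf u v t).ofReal_comp.const_mul _)).2
  have htrans : ∀ t : ℝ, ∫ v, mFourier (-ξ) v • (f (v + torusMk (t • u)) : ℂ) ∂circleVolume n =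
      Complex.exp (t * (((2 * Real.pi * ∑ i, ξ i * u i : ℝ) : ℂ) * Complex.I)) *
        realFourierCoeff f ξ := by
    intro t
    have e : ∀ v, mFourier (-ξ) v = mFourier (-ξ) (v + torusMk (t • u)) *
        Complex.exp (t * (((2 * Real.pi * ∑ i, ξ i * u i : ℝ) : ℂ) * Complex.I)) := by
      intro v
      rw [mFourier_apply_add, mFourier_torusMk, mul_assoc, ← Complex.exp_add]
      have : (((2 * Real.pi * ∑ i, ((-ξ) i : ℤ) * (t • u) i : ℝ) : ℂ) * Complex.I) +
          t * (((2 * Real.pi * ∑ i, ξ i * u i : ℝ) : ℂ) * Complex.I) = 0 := by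
        rw [← mul_assoc, ← add_mul, ← Complex.ofReal_mul, ← Complex.ofReal_add]
        have : (2 * Real.pi * ∑ i, ((-ξ) i : ℤ) * (t • u) i : ℝ) +
            t * (2 * Real.pi * ∑ i, ξ i * u i) = 0 := by
          simp only [Pi.neg_apply, Int.cast_neg, Pi.smul_apply, smul_eq_mul, neg_mul,
            Finset.sum_neg_distrib, mul_left_comm _ t, ← Finset.mul_sum]
          ring
        rw [this]; simp
      rw [this, Complex.exp_zero, mul_one]
    rw [realFourierCoeff, ← integral_add_right_eq_self
      (fun v => mFourier (-ξ) v • (f v : ℂ)) (torusMk (t • u)), ← integral_const_mul]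
    refine integral_congr_ae (ae_of_all _ fun v => ?_)
    dsimp only
    rw [smul_eq_mul, smul_eq_mul]
    conv_lhs => rw [e v]
    ring
  simp only [htrans, zero_smul] at hd
  have h0 : torusMk (0 : Fin n → ℝ) = 0 := by funext i; simp [torusMk]
  simp only [h0, add_zero] at hd
  refine hd.unique ?_
  have h1 : HasDerivAt (fun t : ℝ => (t : ℂ) *
      (((2 * Real.pi * ∑ i, ξ i * u i : ℝ) : ℂ) * Complex.I))
      (((2 * Real.pi * ∑ i, ξ i * u i : ℝ) : ℂ) * Complex.I) 0 := by
    simpa using (hasDerivAt_id (0 : ℝ)).ofReal_comp.mul_const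
      (((2 * Real.pi * ∑ i, ξ i * u i : ℝ) : ℂ) * Complex.I)
  simpa using h1.cexp.mul_const (realFourierCoeff f ξ)

lemma laplacian_torusLift {f : UnitAddTorus (Fin n) → ℝ} (hf : ContDiff ℝ ∞ (torusLift f))
    (x : EuclideanSpace ℝ (Fin n)) :
    Δ (torusLift f) x = ∑ i, torusDeriv (Pi.single i 1) (torusDeriv (Pi.single i 1) f)
      (torusMk x.ofLp) := by
  rw [InnerProductSpace.laplacian_eq_iteratedFDeriv_orthonormalBasis _
    (EuclideanSpace.basisFun (Fin n) ℝ)]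
  refine Finset.sum_congr rfl fun i _ => ?_
  have h1 := contDiff_torusLift_torusDeriv hf (Pi.single i 1)
  have h2 := congrFun (torusLift_torusDeriv h1 (Pi.single i 1)) x
  rw [torusLift] at h2
  rw [h2, torusLift_torusDeriv hf, iteratedFDeriv_two_apply]
  have h3 : DifferentiableAt ℝ (fderiv ℝ (torusLift f)) x :=
    ((hf.fderiv_right (m := ∞) (by simp)).differentiable (by simp)) x
  rw [fderiv_clm_apply h3 (differentiableAt_const _)]
  simp

/-- Fourier coefficients of a Laplace eigenfunction live on one sphere. -/
lemma freqNorm_of_realFourierCoeff_ne_zero {f : UnitAddTorus (Fin n) → ℝ} {l : ℝ} (hl : 0 ≤ l)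
    (hf : ContDiff ℝ ∞ (torusLift f)) (heig : ∀ x, -(Δ (torusLift f) x) = l ^ 2 * torusLift f x)
    {ξ : Fin n → ℤ} (hξ : realFourierCoeff f ξ ≠ 0) : 2 * Real.pi * freqNorm ξ = l := by
  have hfc : Continuous f := continuous_of_torusLift hf.continuous
  have hD := fun i : Fin n => contDiff_torusLift_torusDeriv hf (Pi.single i 1)
  have hDD := fun i : Fin n => contDiff_torusLift_torusDeriv (hD i) (Pi.single i 1)
  have hpt : ∀ v, ∑ i, torusDeriv (Pi.single i 1) (torusDeriv (Pi.single i 1) f) v =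
      -(l ^ 2) * f v := by
    intro v
    obtain ⟨x, rfl, -⟩ := exists_torusMk_eq v
    rw [← laplacian_torusLift hf, neg_mul, ← neg_eq_iff_eq_neg, heig]
    rfl
  have hsum : ∑ i, realFourierCoeff (torusDeriv (Pi.single i 1)
      (torusDeriv (Pi.single i 1) f)) ξ = -(l : ℂ) ^ 2 * realFourierCoeff f ξ := by
    have hi : ∀ i ∈ Finset.univ, Integrable (fun v => mFourier (-ξ) v •
        (torusDeriv (Pi.single i 1) (torusDeriv (Pi.single i 1) f) v : ℂ)) (circleVolume n) :=
      fun i _ => integrable_circleVolume ((mFourier (-ξ)).continuous.smul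
        (Complex.continuous_ofReal.comp (continuous_of_torusLift (hDD i).continuous)))
    unfold realFourierCoeff
    rw [← integral_finsetSum _ hi, ← integral_const_mul]
    refine integral_congr_ae (ae_of_all _ fun v => ?_)
    dsimp only
    rw [← Finset.smul_sum, ← Complex.ofReal_sum, hpt]
    push_cast
    simp only [smul_eq_mul]
    ring
  simp only [realFourierCoeff_torusDeriv (hD _), realFourierCoeff_torusDeriv hf] at hsum
  have hs : ∀ i : Fin n, ∑ j, (ξ j : ℝ) * (Pi.single i 1 : Fin n → ℝ) j = ξ i := by
    intro i; simp [Pi.single_apply]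
  simp only [hs, ← mul_assoc, ← Finset.sum_mul] at hsum
  -- The Laplacian acts on the coefficient by `∑ (2πi ξ_i)²`; a nonzero coefficient cancels, leaving
  -- `(2π|ξ|)² = l²`.
  have h1 := mul_right_cancel₀ hξ hsum
  have h2 : (∑ i, ((2 * Real.pi * (ξ i : ℝ) : ℝ) : ℂ) * Complex.I *
      ((2 * Real.pi * (ξ i : ℝ) : ℝ) : ℂ)) * Complex.I =
      ((-(2 * Real.pi * freqNorm ξ) ^ 2 : ℝ) : ℂ) := by
    rw [mul_pow, freqNorm_sq, Finset.mul_sum, ← Finset.sum_neg_distrib, Complex.ofReal_sum,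
      Finset.sum_mul]
    refine Finset.sum_congr rfl fun i _ => ?_
    push_cast
    linear_combination (2 * (Real.pi : ℂ) * (ξ i : ℂ)) ^ 2 * Complex.I_mul_I
  rw [h2] at h1
  have h3 : (2 * Real.pi * freqNorm ξ) ^ 2 = l ^ 2 := by
    have : ((-(2 * Real.pi * freqNorm ξ) ^ 2 : ℝ) : ℂ) = ((-(l ^ 2) : ℝ) : ℂ) := by
      rw [h1]; push_cast; ring
    linarith [Complex.ofReal_injective this]
  have hfn : 0 ≤ freqNorm ξ := Real.sqrt_nonneg _
  exact (pow_left_inj₀ (by positivity) hl two_ne_zero).1 h3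

lemma finite_freqNorm_le (n : ℕ) (X : ℝ) : {ξ : Fin n → ℤ | freqNorm ξ ≤ X}.Finite := by
  refine (Set.finite_Icc (fun _ : Fin n => -⌈X⌉) fun _ => ⌈X⌉).subset fun ξ hξ => ?_
  have hX : freqNorm ξ ≤ X := hξ
  have h : ∀ i, |ξ i| ≤ ⌈X⌉ := by
    intro i
    have h1 : (|ξ i| : ℝ) ≤ freqNorm ξ := by
      rw [freqNorm, ← Real.sqrt_sq (abs_nonneg (ξ i : ℝ)), sq_abs]
      exact Real.sqrt_le_sqrt (Finset.single_le_sum (f := fun i => (ξ i : ℝ) ^ 2)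
        (fun _ _ => sq_nonneg _) (Finset.mem_univ i))
    have h2 : (|ξ i| : ℝ) ≤ ⌈X⌉ := (h1.trans hX).trans (Int.le_ceil X)
    exact_mod_cast h2
  exact ⟨fun i => (abs_le.1 (h i)).1, fun i => (abs_le.1 (h i)).2⟩

/-- The integer frequencies of length at most `X`. -/
noncomputable def freqBall (n : ℕ) (X : ℝ) : Finset (Fin n → ℤ) := (finite_freqNorm_le n X).toFinset

lemma mem_freqBall {X : ℝ} {ξ : Fin n → ℤ} : ξ ∈ freqBall n X ↔ freqNorm ξ ≤ X := by
  simp [freqBall]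

/-- A function with finitely supported Fourier coefficients is a trigonometric polynomial. -/
lemma eq_sum_realFourierCoeff {f : UnitAddTorus (Fin n) → ℝ} (hf : Continuous f)
    {S : Finset (Fin n → ℤ)} (hS : ∀ ξ, realFourierCoeff f ξ ≠ 0 → ξ ∈ S)
    (v : UnitAddTorus (Fin n)) :
    (f v : ℂ) = ∑ ξ ∈ S, realFourierCoeff f ξ * mFourier ξ v := by
  let F : C(UnitAddTorus (Fin n), ℂ) := ⟨fun v => (f v : ℂ), Complex.continuous_ofReal.comp hf⟩
  have h0 : ∀ ξ ∉ S, realFourierCoeff f ξ = 0 := fun ξ hξ => by_contra fun h => hξ (hS ξ h)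
  have hsum : Summable (mFourierCoeff F) := summable_of_ne_finset_zero (s := S) h0
  have h := hasSum_mFourier_series_apply_of_summable hsum v
  have h' : HasSum (fun ξ => realFourierCoeff f ξ * mFourier ξ v) (f v : ℂ) := h
  exact h'.unique (hasSum_sum_of_ne_finset_zero fun ξ hξ => by rw [h0 ξ hξ, zero_mul])

/-- Parseval's identity for trigonometric polynomials. -/
lemma integral_normSq_sum_mFourier (S : Finset (Fin n → ℤ)) (c : (Fin n → ℤ) → ℂ) :
    ∫ v, ‖∑ ξ ∈ S, c ξ * mFourier (-ξ) v‖ ^ 2 ∂circleVolume n = ∑ ξ ∈ S, ‖c ξ‖ ^ 2 := by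
  apply Complex.ofReal_injective
  rw [← integral_complex_ofReal]
  have e : ∀ v : UnitAddTorus (Fin n), ((‖∑ ξ ∈ S, c ξ * mFourier (-ξ) v‖ ^ 2 : ℝ) : ℂ) =
      ∑ ξ ∈ S, ∑ η ∈ S, c ξ * (starRingEnd ℂ) (c η) * mFourier (-ξ + η) v := by
    intro v
    rw [Complex.ofReal_pow, ← Complex.mul_conj', map_sum, Finset.sum_mul_sum]
    refine Finset.sum_congr rfl fun ξ _ => Finset.sum_congr rfl fun η _ => ?_
    rw [mFourier_add, map_mul, ← mFourier_neg, neg_neg]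
    ring
  have hint : ∀ ξ η, Integrable (fun v : UnitAddTorus (Fin n) =>
      c ξ * (starRingEnd ℂ) (c η) * mFourier (-ξ + η) v) (circleVolume n) :=
    fun ξ η => (integrable_circleVolume (mFourier (-ξ + η)).continuous).const_mul _
  simp only [e]
  rw [integral_finsetSum _ fun ξ _ => integrable_finsetSum _ fun η _ => hint ξ η]
  simp only [integral_finsetSum _ fun η _ => hint _ η, integral_const_mul, integral_mFourier]
  rw [Complex.ofReal_sum]
  refine Finset.sum_congr rfl fun ξ hξ => ?_
  rw [Finset.sum_eq_single ξ]
  · rw [if_pos (neg_add_cancel ξ), mul_one, Complex.mul_conj']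
    push_cast; rfl
  · intro η _ hη
    rw [if_neg (fun h => hη (neg_add_eq_zero.1 h).symm), mul_zero]
  · exact fun h => absurd hξ h

/-- The Kuznecov sum is bounded by the Fourier mass of the measure in a ball. -/
theorem kuznecovSum_le {e : ℕ → FlatTorus n → ℝ} {lam : ℕ → ℝ} (he : IsLaplaceEigenbasis n e lam)
    (μ : Measure (FlatTorus n)) [IsFiniteMeasure μ] (X : ℝ) :
    kuznecovSum e lam μ (2 * Real.pi * X) ≤
      ∑ ξ ∈ freqBall n X, ‖∫ x, mFourier ξ (WithLp.ofLp x) ∂μ‖ ^ 2 := by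
  set S := freqBall n X with hS
  set c : (Fin n → ℤ) → ℂ := fun ξ => ∫ x, mFourier ξ (WithLp.ofLp x) ∂μ with hc
  -- `Q` is the truncated Fourier series of `μ`. For `λ_j ≤ 2πX` the function `e_j` is a
  -- trigonometric polynomial with frequencies in the ball, so integrating it against `μ` or against
  -- `Q` gives the same value. As `e_j` is real, `Re Q` may replace `Q`, and Bessel's inequality
  -- applies to it in the real `L²`.
  set Q : UnitAddTorus (Fin n) → ℂ := fun v => ∑ ξ ∈ S, c ξ * mFourier (-ξ) v with hQ
  have hQc : Continuous Q := continuous_finsetSum _ fun ξ _ =>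
    continuous_const.mul (mFourier (-ξ)).continuous
  have hPc : Continuous fun x : FlatTorus n => (Q (WithLp.ofLp x)).re :=
    Complex.continuous_re.comp (hQc.comp (PiLp.continuous_ofLp 2 _))
  have htoLp : Continuous (WithLp.toLp 2 : UnitAddTorus (Fin n) → FlatTorus n) :=
    PiLp.continuous_toLp 2 _
  have hprob : IsProbabilityMeasure (torusVolume n) :=
    Measure.isProbabilityMeasure_map htoLp.aemeasurable
  have hsm : ∀ j, ContDiff ℝ ∞ (torusLift fun v => e j (WithLp.toLp 2 v)) := he.smooth
  have hfc : ∀ j, Continuous fun v : UnitAddTorus (Fin n) => e j (WithLp.toLp 2 v) :=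
    fun j => continuous_of_torusLift (hsm j).continuous
  have hec : ∀ j, Continuous (e j) := fun j => (hfc j).comp (PiLp.continuous_ofLp 2 _)
  have hlam : ∀ j, 0 ≤ lam j := fun j => he.lam_zero ▸ he.lam_mono (Nat.zero_le j)
  have hint : ∀ ξ : Fin n → ℤ,
      Integrable (fun x : FlatTorus n => mFourier ξ (WithLp.ofLp x)) μ := by
    intro ξ
    have hcont : Continuous fun x : FlatTorus n => mFourier ξ (WithLp.ofLp x) :=
      (mFourier ξ).continuous.comp (PiLp.continuous_ofLp 2 _)
    exact Integrable.of_bound hcont.aestronglyMeasurable 1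
      (ae_of_all _ fun x => (norm_mFourier_apply ξ _).le)
  have hpair : ∀ j, lam j ≤ 2 * Real.pi * X → ∫ x, e j x ∂μ =
      ∫ v, e j (WithLp.toLp 2 v) * (Q v).re ∂circleVolume n := by
    intro j hj
    have hsupp : ∀ ξ, realFourierCoeff (fun v => e j (WithLp.toLp 2 v)) ξ ≠ 0 → ξ ∈ S := by
      intro ξ hξ
      have := freqNorm_of_realFourierCoeff_ne_zero (hlam j) (hsm j) (he.eigen j) hξ
      rw [hS, mem_freqBall]
      rw [← this] at hj
      exact le_of_mul_le_mul_left hj (by positivity)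
    have h1 : ((∫ x, e j x ∂μ : ℝ) : ℂ) =
        ∑ ξ ∈ S, realFourierCoeff (fun v => e j (WithLp.toLp 2 v)) ξ * c ξ := by
      rw [← integral_complex_ofReal]
      have hp : ∀ x : FlatTorus n, (e j x : ℂ) =
          ∑ ξ ∈ S, realFourierCoeff (fun v => e j (WithLp.toLp 2 v)) ξ *
            mFourier ξ (WithLp.ofLp x) :=
        fun x => eq_sum_realFourierCoeff (hfc j) hsupp (WithLp.ofLp x)
      simp only [hp]
      rw [integral_finsetSum _ fun ξ _ => (hint ξ).const_mul _]
      simp only [integral_const_mul, hc]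
    have h2 : ∑ ξ ∈ S, realFourierCoeff (fun v => e j (WithLp.toLp 2 v)) ξ * c ξ =
        ∫ v, (e j (WithLp.toLp 2 v) : ℂ) * Q v ∂circleVolume n := by
      simp only [hQ, Finset.mul_sum]
      have hcont : ∀ ξ ∈ S, Integrable (fun v => (e j (WithLp.toLp 2 v) : ℂ) *
          (c ξ * mFourier (-ξ) v)) (circleVolume n) := fun ξ _ =>
        integrable_circleVolume ((Complex.continuous_ofReal.comp (hfc j)).mul
          (continuous_const.mul (mFourier (-ξ)).continuous))
      rw [integral_finsetSum _ hcont]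
      refine Finset.sum_congr rfl fun ξ _ => ?_
      rw [realFourierCoeff, ← integral_mul_const]
      refine integral_congr_ae (ae_of_all _ fun v => ?_)
      simp only [smul_eq_mul]
      ring
    have h3 := integral_re (𝕜 := ℂ) (integrable_circleVolume
      ((Complex.continuous_ofReal.comp (hfc j)).mul hQc))
    have h4 := congrArg Complex.re (h1.trans h2)
    rw [Complex.ofReal_re] at h4
    rw [h4]
    refine Eq.trans h3.symm (integral_congr_ae (ae_of_all _ fun v => ?_))
    simp
  obtain ⟨b, hb⟩ := he.basis
  have hPmem : MemLp (fun x : FlatTorus n => (Q (WithLp.ofLp x)).re) 2 (torusVolume n) := by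
    obtain ⟨C, hC⟩ := isCompact_univ.exists_bound_of_continuousOn hQc.continuousOn
    exact MemLp.of_bound hPc.aestronglyMeasurable C
      (ae_of_all _ fun x => (Complex.abs_re_le_norm _).trans (hC _ (Set.mem_univ _)))
  have hmap : ∀ g : FlatTorus n → ℝ, Continuous g → ∫ x, g x ∂torusVolume n =
      ∫ v, g (WithLp.toLp 2 v) ∂circleVolume n := fun g hg =>
    integral_map htoLp.aemeasurable hg.aestronglyMeasurable
  set P : Lp ℝ 2 (torusVolume n) := hPmem.toLp _ with hP
  have hPae : P =ᵐ[torusVolume n] fun x => (Q (WithLp.ofLp x)).re := hPmem.coeFn_toLp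
  have hinner : ∀ j, inner ℝ (b j) P =
      ∫ v, e j (WithLp.toLp 2 v) * (Q v).re ∂circleVolume n := by
    intro j
    rw [L2.inner_def, ← hmap (fun x => e j x * (Q (WithLp.ofLp x)).re) ((hec j).mul hPc)]
    refine integral_congr_ae ?_
    filter_upwards [hb j, hPae] with x h1 h2
    rw [h1, h2]
    simp [mul_comm]
  have hnorm : ‖P‖ ^ 2 ≤ ∑ ξ ∈ S, ‖c ξ‖ ^ 2 := by
    rw [← integral_normSq_sum_mFourier, ← real_inner_self_eq_norm_sq, L2.inner_def]
    have : ∫ x, inner ℝ (P x) (P x) ∂torusVolume n =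
        ∫ v, (Q v).re ^ 2 ∂circleVolume n := by
      rw [← hmap (fun x => (Q (WithLp.ofLp x)).re ^ 2) (hPc.pow 2)]
      refine integral_congr_ae ?_
      filter_upwards [hPae] with x h2
      rw [h2]
      simp [sq]
    rw [this]
    refine integral_mono (integrable_circleVolume ((Complex.continuous_re.comp hQc).pow 2))
      (integrable_circleVolume (hQc.norm.pow 2)) fun v => ?_
    exact sq_le_sq' (by linarith [neg_le_abs (Q v).re, Complex.abs_re_le_norm (Q v)])
      (Complex.re_le_norm _)
  refine le_trans ?_ hnorm
  unfold kuznecovSum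
  -- Bounding finite partial sums avoids any appeal to the finiteness of the set of eigenvalues
  -- below the cut-off.
  refine Real.tsum_le_of_sum_le (fun j => sq_nonneg _) fun T => ?_
  have h5 := b.orthonormal.sum_inner_products_le (s := T.map (Function.Embedding.subtype _)) P
  rw [Finset.sum_map] at h5
  refine le_trans (le_of_eq (Finset.sum_congr rfl fun j _ => ?_)) h5
  rw [Function.Embedding.subtype_apply, hinner, hpair j j.2, Real.norm_eq_abs, sq_abs]

end TorusFourier

/-! ### Lattice points in large balls. -/

section LatticePoints

open Pointwise

/-- The number of lattice points in a large ball is asymptotic to its volume. -/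
lemma tendsto_card_freqBall_div (d : ℕ) (hd : 1 ≤ d) :
    Tendsto (fun X : ℝ => ((freqBall d X).card : ℝ) / X ^ d) atTop (𝓝 (ballVol d)) := by
  set B : Set (Fin d → ℝ) := WithLp.toLp 2 ⁻¹' Metric.closedBall (0 : EuclideanSpace ℝ (Fin d)) 1
    with hB
  have hmemB : ∀ x : Fin d → ℝ, x ∈ B ↔ ∑ i, x i ^ 2 ≤ 1 := by
    intro x
    rw [hB, Set.mem_preimage, mem_closedBall_zero_iff, EuclideanSpace.norm_eq, Real.sqrt_le_one]
    simp
  have hclosed : IsClosed B := Metric.isClosed_closedBall.preimage (PiLp.continuous_toLp 2 _)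
  have hbdd : Bornology.IsBounded B := by
    refine (Metric.isBounded_closedBall (x := (0 : Fin d → ℝ)) (r := 1)).subset fun x hx => ?_
    rw [mem_closedBall_zero_iff, pi_norm_le_iff_of_nonneg zero_le_one]
    intro i
    rw [Real.norm_eq_abs, ← sq_le_one_iff_abs_le_one]
    exact (Finset.single_le_sum (f := fun i => x i ^ 2) (fun _ _ => sq_nonneg _)
      (Finset.mem_univ i)).trans ((hmemB x).1 hx)
  have hconv : Convex ℝ B :=
    (convex_closedBall (0 : EuclideanSpace ℝ (Fin d)) 1).linear_preimage
      (WithLp.linearEquiv 2 ℝ (Fin d → ℝ)).symm.toLinearMap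
  -- Monotonicity of the dilates gives the counting limit along real `X`, not only along integers.
  have hstar : ∀ ⦃x y : ℝ⦄, 0 < x → x ≤ y → x • B ⊆ y • B := by
    intro x y hx hxy v hv
    obtain ⟨u, hu, rfl⟩ := hv
    have hy : 0 < y := hx.trans_le hxy
    refine ⟨(x / y) • u, ?_, ?_⟩
    · rw [hmemB] at hu ⊢
      have h1 : (x / y) ^ 2 ≤ 1 := pow_le_one₀ (by positivity) ((div_le_one hy).2 hxy)
      simp only [Pi.smul_apply, smul_eq_mul, mul_pow, ← Finset.mul_sum]
      exact mul_le_one₀ h1 (Finset.sum_nonneg fun _ _ => sq_nonneg _) hu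
    · simp only [smul_smul]
      rw [mul_div_cancel₀ _ hy.ne']
  have hvol : volume.real B = ballVol d := by
    rw [measureReal_def, hB, (PiLp.volume_preserving_toLp (Fin d)).measure_preimage
      Metric.isClosed_closedBall.measurableSet.nullMeasurableSet, ← measureReal_def,
      volume_real_closedBall hd zero_le_one, Real.one_rpow, mul_one]
  have h := tendsto_card_div_pow_atTop_volume' B hbdd hclosed.measurableSet
    (hconv.addHaar_frontier volume) hstar
  rw [hvol, Fintype.card_fin] at h
  refine h.congr' ?_
  filter_upwards [eventually_gt_atTop 0] with X hX
  congr 2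
  -- Points of the rescaled lattice `X⁻¹ ℤ^d` in the unit ball correspond to integer points in the
  -- ball of radius `X`.
  have himg : B ∩ X⁻¹ • (Submodule.span ℤ (Set.range (Pi.basisFun ℝ (Fin d))) : Set (Fin d → ℝ)) =
      (fun ξ : Fin d → ℤ => X⁻¹ • fun i => (ξ i : ℝ)) '' (freqBall d X : Set (Fin d → ℤ)) := by
    have hball : ∀ ξ : Fin d → ℤ, (X⁻¹ • fun i => (ξ i : ℝ)) ∈ B ↔ ξ ∈ freqBall d X := by
      intro ξ
      rw [hmemB, mem_freqBall, freqNorm, Real.sqrt_le_left hX.le]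
      simp only [Pi.smul_apply, smul_eq_mul, mul_pow, ← Finset.mul_sum]
      rw [inv_pow, inv_mul_le_iff₀ (by positivity), mul_one]
    ext x
    constructor
    · rintro ⟨hxB, y, hy, rfl⟩
      rw [SetLike.mem_coe, Module.Basis.mem_span_iff_repr_mem] at hy
      choose ξ hξ using hy
      have hyξ : y = fun i => (ξ i : ℝ) := funext fun i => by simpa using (hξ i).symm
      subst hyξ
      exact ⟨ξ, (hball ξ).1 hxB, rfl⟩
    · rintro ⟨ξ, hξ, rfl⟩
      refine ⟨(hball ξ).2 hξ, _, ?_, rfl⟩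
      rw [SetLike.mem_coe, Module.Basis.mem_span_iff_repr_mem]
      exact fun i => ⟨ξ i, by simp⟩
  rw [himg, Nat.card_image_of_injective, Nat.card_coe_set_eq, Set.ncard_coe_finset]
  intro ξ η hξη
  funext i
  have := congrFun hξη i
  simpa [hX.ne'] using this

end LatticePoints

/-! ### Fourier mass of the lacunary measure. -/

section LacunaryFourier

open UnitAddTorus

variable {s : ℕ} {a : ℕ → ℝ} {k : ℕ → Fin s → ℤ}

/-- Parseval's identity for continuous real functions on the torus. -/
lemma hasSum_norm_sq_realFourierCoeff {f : UnitAddTorus (Fin s) → ℝ} (hf : Continuous f) :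
    HasSum (fun ξ => ‖realFourierCoeff f ξ‖ ^ 2) (∫ v, f v ^ 2 ∂circleVolume s) := by
  let F : C(UnitAddTorus (Fin s), ℂ) := ⟨fun v => (f v : ℂ), Complex.continuous_ofReal.comp hf⟩
  have h := hasSum_sq_mFourierCoeff (F.toLp 2 (circleVolume s) ℂ)
  have h1 : ∀ ξ, mFourierCoeff (F.toLp 2 (circleVolume s) ℂ) ξ = realFourierCoeff f ξ :=
    fun ξ => mFourierCoeff_toLp F ξ
  have h2 : ∫ v, ‖(F.toLp 2 (circleVolume s) ℂ) v‖ ^ 2 ∂circleVolume s =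
      ∫ v, f v ^ 2 ∂circleVolume s := by
    refine integral_congr_ae ?_
    filter_upwards [ContinuousMap.coeFn_toLp (𝕜 := ℂ) (p := 2) (circleVolume s) F] with v hv
    rw [hv]
    simp [F]
  have e : (fun ξ => ‖realFourierCoeff f ξ‖ ^ 2) =
      fun ξ => ‖mFourierCoeff (F.toLp 2 (circleVolume s) ℂ) ξ‖ ^ 2 :=
    funext fun ξ => by rw [h1]
  rw [← h2, e]
  exact h

variable (ha : IsAdmissible a)
include ha

/-- Each cosine is the half-sum of the exponentials at `±k_j`. The lengths are distinct, so only the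
`m`-th term meets the frequencies `±k_m`. -/
lemma IsAdmissible.realFourierCoeff_density
    (hk : ∀ m, k m ≠ 0) (hmono : StrictMono fun m => freqNorm (k m)) (m : ℕ) {ξ : Fin s → ℤ}
    (hξ : ξ = k m ∨ ξ = -k m) : realFourierCoeff (lacunaryDensity a k) ξ = (a m / 2 : ℝ) := by
  have hξ0 : -ξ ≠ 0 := by
    rcases hξ with rfl | rfl
    · exact neg_ne_zero.2 (hk m)
    · simpa using hk m
  have h := hasSum_integral_lacunaryDensity_smul (k := k) ha.summable ha.nonneg
    (mFourier (-ξ)).continuous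
  rw [integral_mFourier_of_ne hξ0, sub_zero] at h
  have hterm : ∀ j, ∫ v, cosWave (k j) v • mFourier (-ξ) v ∂circleVolume s =
      ((if k j - ξ = 0 then 1 else 0) + if -k j - ξ = 0 then 1 else 0) / 2 := by
    intro j
    have e : ∀ v, cosWave (k j) v • mFourier (-ξ) v =
        (mFourier (k j - ξ) v + mFourier (-k j - ξ) v) / 2 := by
      intro v
      rw [Complex.real_smul, ofReal_cosWave, sub_eq_add_neg, sub_eq_add_neg, mFourier_add,
        mFourier_add]
      ring
    simp only [e]
    rw [integral_div, integral_add (integrable_circleVolume (mFourier _).continuous)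
      (integrable_circleVolume (mFourier _).continuous), integral_mFourier, integral_mFourier]
  simp only [hterm] at h
  have hcoef : realFourierCoeff (lacunaryDensity a k) ξ =
      ∫ v, lacunaryDensity a k v • mFourier (-ξ) v ∂circleVolume s := by
    refine integral_congr_ae (ae_of_all _ fun v => ?_)
    simp [mul_comm]
  rw [hcoef]
  refine h.unique ?_
  convert hasSum_single m ?_ using 1
  · rcases hξ with rfl | rfl
    · rw [sub_self, if_pos rfl, if_neg (by
        rw [← neg_add']; exact neg_ne_zero.2 (add_self_ne_zero_freq (hk m)))]
      rw [Complex.real_smul]; push_cast; ring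
    · rw [sub_neg_eq_add, if_neg (add_self_ne_zero_freq (hk m)), sub_self, if_pos rfl]
      rw [Complex.real_smul]; push_cast; ring
  · intro j hj
    obtain ⟨h1, h2⟩ := freqNorm_injective_signs hmono hj
    have h3 : -k j - k m ≠ 0 := by rw [← neg_add']; exact neg_ne_zero.2 h1
    have h4 : -k j - -k m ≠ 0 := by rw [← neg_sub', neg_ne_zero]; exact h2
    rcases hξ with rfl | rfl
    · rw [if_neg h2, if_neg h3]; simp
    · rw [sub_neg_eq_add, if_neg h1, ← sub_neg_eq_add, if_neg h4]; simp

/-- Below the frequency `|k_m|`, the Fourier mass of the density misses the `m`-th wave. -/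
lemma IsAdmissible.sum_norm_sq_realFourierCoeff_le
    (hk : ∀ m, k m ≠ 0) (hmono : StrictMono fun m => freqNorm (k m)) (m : ℕ) {X : ℝ}
    (hX : X < freqNorm (k m)) :
    ∑ ξ ∈ freqBall s X, ‖realFourierCoeff (lacunaryDensity a k) ξ‖ ^ 2 ≤
      lacunaryCorr a k 0 - a m ^ 2 / 2 := by
  have h := hasSum_norm_sq_realFourierCoeff (ha.continuous_density (k := k))
  rw [integral_sq_lacunaryDensity ha.summable ha.nonneg hk hmono, ← lacunaryCorr_zero (k := k)] at h
  have h1 : k m ∉ freqBall s X := fun h => hX.not_ge (mem_freqBall.1 h)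
  have h2 : -k m ∉ freqBall s X := fun h => hX.not_ge (freqNorm_neg (k m) ▸ mem_freqBall.1 h)
  have h3 : -k m ≠ k m := fun h => add_self_ne_zero_freq (hk m) (neg_eq_iff_add_eq_zero.1 h)
  -- The two frequencies `±k_m` lie outside the ball and carry mass `a_m²/4` each; the total mass is
  -- `∫ w² = A`.
  have hle := sum_le_hasSum (insert (-k m) (insert (k m) (freqBall s X)))
    (fun _ _ => sq_nonneg _) h
  rw [Finset.sum_insert (by simp [h2, h3]), Finset.sum_insert h1,
    ha.realFourierCoeff_density hk hmono m (Or.inl rfl),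
    ha.realFourierCoeff_density hk hmono m (Or.inr rfl), Complex.norm_real, Real.norm_eq_abs,
    sq_abs] at hle
  linarith

/-- The Kuznecov sum of a lacunary measure, below the frequency `|k_m|`. -/
lemma IsAdmissible.kuznecovSum_le {d : ℕ}
    (hk : ∀ m, k m ≠ 0) (hmono : StrictMono fun m => freqNorm (k m)) (m : ℕ) {X : ℝ}
    (hX : X < freqNorm (k m)) {e : ℕ → FlatTorus (s + d) → ℝ} {lam : ℕ → ℝ}
    (he : IsLaplaceEigenbasis (s + d) e lam) :
    kuznecovSum e lam (lacunaryMeasure (s + d) a k) (2 * Real.pi * X) ≤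
      (freqBall d X).card * (lacunaryCorr a k 0 - a m ^ 2 / 2) := by
  have := ha.isFiniteMeasure_lacunaryMeasure (n := s + d) (k := k)
  refine (_root_.kuznecovSum_le he _ X).trans ?_
  -- The measure sits at 0 in the last `d` coordinates, so its Fourier transform ignores the
  -- transverse frequency.
  have hcoef : ∀ ξ : Fin (s + d) → ℤ,
      ∫ x, mFourier ξ (WithLp.ofLp x) ∂lacunaryMeasure (s + d) a k =
        realFourierCoeff (lacunaryDensity a k) (-fun i => ξ (Fin.castAdd d i)) := by
    intro ξ
    have hcont : Continuous fun x : FlatTorus (s + d) => mFourier ξ (WithLp.ofLp x) :=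
      (mFourier ξ).continuous.comp (PiLp.continuous_ofLp 2 _)
    rw [ha.integral_lacunaryMeasure hcont.aestronglyMeasurable, realFourierCoeff]
    refine integral_congr_ae (ae_of_all _ fun v => ?_)
    have hm : mFourier ξ (WithLp.ofLp (subtorusIncl s (s + d) v)) =
        mFourier (fun i => ξ (Fin.castAdd d i)) v := by
      simp [mFourier, Fin.prod_univ_add, subtorusIncl]
    dsimp only
    rw [hm, neg_neg, Complex.real_smul, smul_eq_mul, mul_comm]
  simp only [hcoef]
  set φ : (Fin (s + d) → ℤ) → (Fin s → ℤ) × (Fin d → ℤ) :=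
    fun ξ => (-fun i => ξ (Fin.castAdd d i), fun j => ξ (Fin.natAdd s j)) with hφ
  have hinj : Function.Injective φ := by
    intro ξ η h
    have h1 := congrArg Prod.fst h
    have h2 := congrArg Prod.snd h
    simp only [hφ, neg_inj] at h1 h2
    funext i
    refine Fin.addCases (fun i => congrFun h1 i) (fun j => congrFun h2 j) i
  -- Enlarging the ball to a product of balls separates the sums and still gives the sharp leading
  -- constant `vol(B^d)` from the transverse count.
  have hmaps : (freqBall (s + d) X).image φ ⊆ freqBall s X ×ˢ freqBall d X := by
    intro p hp
    obtain ⟨ξ, hξ, rfl⟩ := Finset.mem_image.1 hp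
    rw [mem_freqBall, freqNorm, Fin.sum_univ_add] at hξ
    rw [Finset.mem_product, mem_freqBall, mem_freqBall, freqNorm_neg]
    constructor <;> refine le_trans (Real.sqrt_le_sqrt ?_) hξ
    · exact le_add_of_nonneg_right (Finset.sum_nonneg fun _ _ => sq_nonneg _)
    · exact le_add_of_nonneg_left (Finset.sum_nonneg fun _ _ => sq_nonneg _)
  calc ∑ ξ ∈ freqBall (s + d) X,
        ‖realFourierCoeff (lacunaryDensity a k) (-fun i => ξ (Fin.castAdd d i))‖ ^ 2
      = ∑ p ∈ (freqBall (s + d) X).image φ, ‖realFourierCoeff (lacunaryDensity a k) p.1‖ ^ 2 := by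
        rw [Finset.sum_image hinj.injOn]
    _ ≤ ∑ p ∈ freqBall s X ×ˢ freqBall d X, ‖realFourierCoeff (lacunaryDensity a k) p.1‖ ^ 2 :=
        Finset.sum_le_sum_of_subset_of_nonneg hmaps fun _ _ _ => sq_nonneg _
    _ = (freqBall d X).card * ∑ η ∈ freqBall s X,
          ‖realFourierCoeff (lacunaryDensity a k) η‖ ^ 2 := by
        rw [Finset.sum_product_right]
        dsimp only
        rw [Finset.sum_const, nsmul_eq_mul]
    _ ≤ _ := by
        gcongr
        exact ha.sum_norm_sq_realFourierCoeff_le hk hmono m hX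

end LacunaryFourier

/-! ### Choice of thresholds and failure of the rates. -/

section Thresholds

/-- Along the sequence the ratio `|f|/|g|` is unbounded. The condition `f (x m) ≠ 0` covers zeros of
`g`, where the lower bound says nothing; this matters because `ψ` may vanish. -/
lemma not_isBigO_of_seq {α : Type*} {l : Filter α} {f g : α → ℝ} {x : ℕ → α}
    (hx : Tendsto x atTop l) {c : ℝ} (hc : 0 < c) (hpos : ∀ m, f (x m) ≠ 0)
    (h : ∀ m : ℕ, c * (m + 1) * |g (x m)| ≤ |f (x m)|) : ¬ f =O[l] g := by
  intro hO
  obtain ⟨C, hC, hb⟩ := hO.exists_pos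
  rw [isBigOWith_iff] at hb
  obtain ⟨m, hm, hmC⟩ := ((hx.eventually hb).and (eventually_ge_atTop ⌈C / c⌉₊)).exists
  have h1 : C < c * (m + 1) := by
    rw [← div_lt_iff₀' hc]
    have : C / c ≤ m := (Nat.le_ceil _).trans (by exact_mod_cast hmC)
    linarith
  simp only [Real.norm_eq_abs] at hm
  have hfpos : 0 < |f (x m)| := abs_pos.2 (hpos m)
  have hgpos : 0 < |g (x m)| := by
    by_contra hcon
    rw [le_antisymm (not_lt.1 hcon) (abs_nonneg _), mul_zero] at hm
    linarith
  nlinarith [h m]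

lemma tendsto_integral_Ioi_gaussWeight {s : ℝ} (hs : 0 < s) :
    Tendsto (fun R : ℝ => ∫ u in Set.Ioi R, gaussWeight s u) atTop (𝓝 0) := by
  have h1 := intervalIntegral_tendsto_integral_Ioi 0 (integrableOn_gaussWeight hs) tendsto_id
  have h2 := (tendsto_const_nhds (x := ∫ u in Set.Ioi 0, gaussWeight s u)).sub h1
  rw [sub_self] at h2
  refine h2.congr' ?_
  filter_upwards [eventually_ge_atTop 0] with R hR
  have hw := integrableOn_gaussWeight hs
  rw [id, intervalIntegral.integral_of_le hR, ← Set.Ioc_union_Ioi_eq_Ioi hR,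
    setIntegral_union (Set.Ioc_disjoint_Ioi le_rfl) measurableSet_Ioi
      (hw.mono_set fun x hx => hx.1) (hw.mono_set fun x hx => lt_of_le_of_lt hR hx),
    add_sub_cancel_left]

/-- The size of `1 - q` produced by the `m`-th wave at scale `1 / |k_m|`. -/
noncomputable def waveDefect (s : ℕ) (a : ℕ → ℝ) (m : ℕ) : ℝ := a m ^ 2 / 4 * (1 / 16) ^ (s : ℝ)

/-- The conditions on the length `R` of the `m`-th frequency. -/
structure IsFarFrequency (s d : ℕ) (a : ℕ → ℝ) (δ : ℝ) (ψ : ℝ → ℝ) (m : ℕ) (R : ℝ) : Prop where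
  -- The factor `m + 1` in `rate`, `gauss` and `power` makes the ratios unbounded, and `index_le`
  -- sends the lengths to infinity.
  six_le : 6 ≤ R
  index_le : m ≤ R
  rate : (m + 1) * |ψ (1 / R)| ≤ waveDefect s a m
  tail : 3 ^ (s : ℝ) / ballVol s * ∫ u in Set.Ioi (R / 3), gaussWeight s u ≤
    waveDefect s a m * (∫ u in (1 : ℝ)..2, gaussWeight s u) / 2
  gauss : (m + 1) * ((1 / R) ^ 2) ^ (δ / 2) ≤ waveDefect s a m
  -- The excess `a_m²/8` in the lattice count is affordable: since `A ≤ 2`, `(1 + a_m²/8)(A -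
  -- a_m²/2) ≤ A - a_m²/4`.
  lattice : (freqBall d (R / 2)).card ≤ ballVol d * (1 + a m ^ 2 / 8) * (R / 2) ^ (d : ℝ)
  power : m + 1 ≤ a m ^ 2 * (R / 2) ^ δ

lemma eventually_isFarFrequency {s d : ℕ} (hs : 1 ≤ s) (hd : 1 ≤ d) {a : ℕ → ℝ}
    (ha : ∀ m, 0 < a m) {δ : ℝ} (hδ : 0 < δ) {ψ : ℝ → ℝ} (hψ : Tendsto ψ (𝓝[>] 0) (𝓝 0)) (m : ℕ) :
    ∀ᶠ R in atTop, IsFarFrequency s d a δ ψ m R := by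
  have hs0 : (0 : ℝ) < s := by positivity
  have hb := ballVol_pos (s := (d : ℝ)) (by positivity)
  have hm : (0 : ℝ) < m + 1 := by positivity
  have ham := ha m
  have hη : 0 < waveDefect s a m := by unfold waveDefect; positivity
  have hW := integral_gaussWeight_pos hs0 zero_le_one one_lt_two
  have hinv : Tendsto (fun R : ℝ => 1 / R) atTop (𝓝[>] 0) := by
    simpa using tendsto_inv_atTop_nhdsGT_zero
  have hhalf : Tendsto (fun R : ℝ => R / 2) atTop atTop := tendsto_id.atTop_div_const two_pos
  have hthird : Tendsto (fun R : ℝ => R / 3) atTop atTop := tendsto_id.atTop_div_const three_pos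
  have e1 : ∀ᶠ R : ℝ in atTop, (m + 1) * |ψ (1 / R)| < waveDefect s a m := by
    have := ((hψ.comp hinv).abs.const_mul ((m : ℝ) + 1))
    rw [abs_zero, mul_zero] at this
    exact this.eventually_lt_const hη
  have e2 : ∀ᶠ R : ℝ in atTop, 3 ^ (s : ℝ) / ballVol s * ∫ u in Set.Ioi (R / 3), gaussWeight s u <
      waveDefect s a m * (∫ u in (1 : ℝ)..2, gaussWeight s u) / 2 := by
    have := ((tendsto_integral_Ioi_gaussWeight hs0).comp hthird).const_mul
      (3 ^ (s : ℝ) / ballVol s)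
    rw [mul_zero] at this
    exact this.eventually_lt_const (by positivity)
  have e3 : ∀ᶠ R : ℝ in atTop, (m + 1) * ((1 / R) ^ 2) ^ (δ / 2) < waveDefect s a m := by
    have h0 : Tendsto (fun t : ℝ => (t ^ 2) ^ (δ / 2)) (𝓝[>] 0) (𝓝 0) := by
      have hc : ContinuousAt (fun t : ℝ => (t ^ 2) ^ (δ / 2)) 0 :=
        ((continuous_pow 2).rpow_const fun _ => Or.inr (by positivity)).continuousAt
      have := hc.tendsto
      rw [zero_pow two_ne_zero, Real.zero_rpow (by positivity)] at this
      exact this.mono_left nhdsWithin_le_nhds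
    have := (h0.comp hinv).const_mul ((m : ℝ) + 1)
    rw [mul_zero] at this
    exact this.eventually_lt_const hη
  have e4 : ∀ᶠ R : ℝ in atTop, ((freqBall d (R / 2)).card : ℝ) / (R / 2) ^ d <
      ballVol d * (1 + a m ^ 2 / 8) := by
    refine ((tendsto_card_freqBall_div d hd).comp hhalf).eventually_lt_const ?_
    have : 0 < a m ^ 2 := by positivity
    nlinarith
  have e5 : ∀ᶠ R : ℝ in atTop, m + 1 ≤ a m ^ 2 * (R / 2) ^ δ :=
    (((tendsto_rpow_atTop hδ).comp hhalf).const_mul_atTop (by positivity)).eventually_ge_atTop _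
  filter_upwards [e1, e2, e3, e4, e5, eventually_ge_atTop 6, eventually_ge_atTop (m : ℝ)] with
    R h1 h2 h3 h4 h5 h6 h7
  refine ⟨h6, h7, h1.le, h2.le, h3.le, ?_, h5⟩
  rw [Real.rpow_natCast]
  exact ((div_lt_iff₀ (by positivity)).1 h4).le

variable {s : ℕ} {a : ℕ → ℝ} {k : ℕ → Fin s → ℤ}

/-- A measure with far frequencies has arbitrarily slow convergence. -/
lemma lacunaryMeasure_slow {d : ℕ} (hs : 1 ≤ s)
    (ha : ∀ m, 0 < a m) (had : IsAdmissible a) {δ : ℝ} {ψ : ℝ → ℝ}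
    (hk : ∀ m, k m ≠ 0) (hmono : StrictMono fun m => freqNorm (k m))
    (hfar : ∀ m, IsFarFrequency s d a δ ψ m (freqNorm (k m))) :
    ¬ ((fun r : ℝ => normDistDistribution (lacunaryMeasure (s + d) a k) (s : ℝ)
        (lacunaryCorr a k 0) r - 1) =O[𝓝[>] 0] ψ) ∧
    ¬ ((fun t : ℝ => gaussianAverage (lacunaryMeasure (s + d) a k) t / t ^ ((s : ℝ) / 2)
        - gammaConst (s : ℝ) * lacunaryCorr a k 0) =O[𝓝[>] 0] fun t : ℝ => t ^ (δ / 2)) ∧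
    ∀ (e : ℕ → FlatTorus (s + d) → ℝ) (lam : ℕ → ℝ), IsLaplaceEigenbasis (s + d) e lam →
      ¬ HasPowerSaving e lam (lacunaryMeasure (s + d) a k) (s : ℝ) (lacunaryCorr a k 0) δ := by
  have hs0 : (0 : ℝ) < s := by positivity
  have hb := ballVol_pos hs0.le
  have hbd := ballVol_pos (s := (d : ℝ)) (by positivity)
  have hW := integral_gaussWeight_pos hs0 zero_le_one one_lt_two
  have hη : ∀ m, 0 < waveDefect s a m := fun m => by
    have := ha m
    unfold waveDefect; positivity
  have hR0 : ∀ m, 0 < freqNorm (k m) := fun m => freqNorm_pos (hk m)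
  obtain ⟨hA1, hA2⟩ := had.corr_zero_mem (k := k)
  have htop : Tendsto (fun m => freqNorm (k m)) atTop atTop :=
    tendsto_atTop_mono (fun m => (hfar m).index_le) tendsto_natCast_atTop_atTop
  have hinv : Tendsto (fun m => 1 / freqNorm (k m)) atTop (𝓝[>] 0) := by
    simp only [one_div]
    exact tendsto_inv_atTop_nhdsGT_zero.comp htop
  refine ⟨?_, ?_, ?_⟩
  · have hq : ∀ m, normDistDistribution (lacunaryMeasure (s + d) a k) (s : ℝ)
        (lacunaryCorr a k 0) (1 / freqNorm (k m)) - 1 ≤ -waveDefect s a m := by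
      intro m
      have h6 := (hfar m).six_le
      have := had.normDistDistribution_le_sub hs (Nat.le_add_right s d) hk hmono m
        (r := 1 / freqNorm (k m)) (by rw [mul_one_div_cancel (hR0 m).ne'])
        (by rw [mul_one_div_cancel (hR0 m).ne']; norm_num)
        (by rw [div_lt_div_iff₀ (hR0 m) two_pos]; linarith)
      unfold waveDefect
      linarith
    refine not_isBigO_of_seq hinv one_pos (fun m => ?_) fun m => ?_
    · have := hq m
      have := hη m
      linarith
    · rw [one_mul]
      refine (hfar m).rate.trans (le_trans ?_ (neg_le_abs _))
      linarith [hq m]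
  · have hG : ∀ m, gaussianAverage (lacunaryMeasure (s + d) a k) ((1 / freqNorm (k m)) ^ 2) /
        ((1 / freqNorm (k m)) ^ 2) ^ ((s : ℝ) / 2) - gammaConst s * lacunaryCorr a k 0 ≤
        -(ballVol s * (∫ u in (1 : ℝ)..2, gaussWeight s u) / 2 * waveDefect s a m) := by
      intro m
      refine (had.gaussianAverage_le hs (Nat.le_add_right s d) hk hmono m (hfar m).six_le).trans ?_
      have h1 := (hfar m).tail
      have h2 : 0 < waveDefect s a m * ∫ u in (1 : ℝ)..2, gaussWeight s u := mul_pos (hη m) hW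
      change _ * _ * (-(waveDefect s a m * _) + _) ≤ _
      -- By `tail`, the far range consumes at most half of the block's deficit; then `A ≥ 1` is
      -- dropped.
      calc _ ≤ ballVol s * lacunaryCorr a k 0 *
            (-(waveDefect s a m * (∫ u in (1 : ℝ)..2, gaussWeight s u) / 2)) := by
            gcongr; linarith
        _ ≤ ballVol s * 1 *
            (-(waveDefect s a m * (∫ u in (1 : ℝ)..2, gaussWeight s u) / 2)) := by
            rw [mul_neg, mul_neg, neg_le_neg_iff]
            gcongr
        _ = _ := by ring
    have hc : 0 < ballVol s * (∫ u in (1 : ℝ)..2, gaussWeight s u) / 2 := by positivity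
    have hsq : Tendsto (fun m => (1 / freqNorm (k m)) ^ 2) atTop (𝓝[>] 0) := by
      refine tendsto_nhdsWithin_iff.2 ⟨?_, Eventually.of_forall fun m => ?_⟩
      · simpa using (hinv.mono_right nhdsWithin_le_nhds).pow 2
      · have := hR0 m
        exact Set.mem_Ioi.2 (by positivity)
    refine not_isBigO_of_seq hsq hc (fun m => ?_) fun m => ?_
    · have := hG m
      have := mul_pos hc (hη m)
      linarith
    · have h1 : 0 ≤ ((1 / freqNorm (k m)) ^ 2) ^ (δ / 2) := by positivity
      refine le_trans ?_ (neg_le_abs _)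
      rw [abs_of_nonneg h1, mul_assoc]
      have := mul_le_mul_of_nonneg_left (hfar m).gauss hc.le
      linarith [hG m]
  · intro e lam he
    -- The test point is `λ = 2πX` with `X = |k_m|/2`, safely below the length `|k_m|` of the
    -- missing wave.
    have hN : ∀ m, kuznecovSum e lam (lacunaryMeasure (s + d) a k)
        (2 * Real.pi * (freqNorm (k m) / 2)) - kuznecovConst ((s + d : ℕ) : ℝ) s *
          lacunaryCorr a k 0 * (2 * Real.pi * (freqNorm (k m) / 2)) ^ (((s + d : ℕ) : ℝ) - s) ≤
        -(ballVol d / 4 * (a m ^ 2 * (freqNorm (k m) / 2) ^ (d : ℝ))) := by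
      intro m
      have hX : 0 < freqNorm (k m) / 2 := half_pos (hR0 m)
      have h1 := had.kuznecovSum_le hk hmono m (half_lt_self (hR0 m)) he
      have hXd : 0 < (freqNorm (k m) / 2) ^ (d : ℝ) := Real.rpow_pos_of_pos hX _
      have hd : ((s + d : ℕ) : ℝ) - s = d := by push_cast; ring
      have hmain : kuznecovConst ((s + d : ℕ) : ℝ) s * lacunaryCorr a k 0 *
          (2 * Real.pi * (freqNorm (k m) / 2)) ^ (((s + d : ℕ) : ℝ) - s) =
          ballVol d * lacunaryCorr a k 0 * (freqNorm (k m) / 2) ^ (d : ℝ) := by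
        have h2 : (2 * Real.pi) ^ (-(d : ℝ)) * (2 * Real.pi) ^ (d : ℝ) = 1 := by
          rw [← Real.rpow_add (by positivity), neg_add_cancel, Real.rpow_zero]
        rw [kuznecovConst, hd, Real.mul_rpow (by positivity) hX.le]
        linear_combination (ballVol d * lacunaryCorr a k 0 * (freqNorm (k m) / 2) ^ (d : ℝ)) * h2
      rw [hmain]
      have ha4 : a m ≤ 1 / 4 :=
        (had.summable.le_tsum m fun j _ => had.nonneg j).trans had.tsum_le
      have ham := ha m
      have h3 : 0 ≤ lacunaryCorr a k 0 - a m ^ 2 / 2 := by nlinarith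
      have h4 := mul_le_mul_of_nonneg_right (hfar m).lattice h3
      have h5 : ballVol d * (1 + a m ^ 2 / 8) * (freqNorm (k m) / 2) ^ (d : ℝ) *
          (lacunaryCorr a k 0 - a m ^ 2 / 2) ≤ ballVol d * (freqNorm (k m) / 2) ^ (d : ℝ) *
            (lacunaryCorr a k 0 - a m ^ 2 / 4) := by
        have h6 : (1 + a m ^ 2 / 8) * (lacunaryCorr a k 0 - a m ^ 2 / 2) ≤
            lacunaryCorr a k 0 - a m ^ 2 / 4 := by nlinarith [sq_nonneg (a m)]
        have := mul_le_mul_of_nonneg_left h6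
          (show 0 ≤ ballVol d * (freqNorm (k m) / 2) ^ (d : ℝ) by positivity)
        linarith
      linarith
    -- The constant absorbs the factor `(2π)^{d-δ}` that appears when `λ^{d-δ}` is expressed through
    -- `X`.
    have hc : 0 < ballVol d / (4 * (2 * Real.pi) ^ ((d : ℝ) - δ)) := by
      have := Real.pi_pos
      positivity
    have hlim : Tendsto (fun m => 2 * Real.pi * (freqNorm (k m) / 2)) atTop atTop :=
      (htop.atTop_div_const two_pos).const_mul_atTop (by positivity)
    unfold HasPowerSaving
    refine not_isBigO_of_seq hlim hc (fun m => ?_) fun m => ?_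
    · have h1 := hN m
      have hX : 0 < freqNorm (k m) / 2 := half_pos (hR0 m)
      have h2 : 0 < ballVol d / 4 * (a m ^ 2 * (freqNorm (k m) / 2) ^ (d : ℝ)) := by
        have := ha m
        positivity
      linarith
    · refine le_trans ?_ (neg_le_abs _)
      refine le_trans ?_ (le_neg_of_le_neg (hN m))
      have hX : 0 < freqNorm (k m) / 2 := half_pos (hR0 m)
      have hd : ((s + d : ℕ) : ℝ) - s - δ = d - δ := by push_cast; ring
      have hXpos : 0 < (freqNorm (k m) / 2) ^ ((d : ℝ) - δ) := Real.rpow_pos_of_pos hX _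
      have hpi : 0 < (2 * Real.pi) ^ ((d : ℝ) - δ) := by positivity
      rw [hd, abs_of_nonneg (by positivity), Real.mul_rpow (by positivity) hX.le]
      have h1 := mul_le_mul_of_nonneg_right (hfar m).power hXpos.le
      rw [mul_assoc (a m ^ 2), ← Real.rpow_add hX, add_sub_cancel] at h1
      calc _ = ballVol d / 4 * ((m + 1) * (freqNorm (k m) / 2) ^ ((d : ℝ) - δ)) := by
            field_simp
        _ ≤ _ := by gcongr

/-- Integers growing faster than prescribed thresholds. -/
noncomputable def lacunaryLength (Φ : ℕ → ℝ → ℝ) : ℕ → ℕ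
  | 0 => ⌈Φ 0 0⌉₊ + 1
  | m + 1 => max ⌈Φ (m + 1) (lacunaryLength Φ m)⌉₊ (lacunaryLength Φ m) + 1

/-- Lacunary frequencies along the first axis exist for all thresholds. -/
lemma exists_isLacunary (hs : 1 ≤ s) (Φ : ℕ → ℝ → ℝ) : ∃ k : ℕ → Fin s → ℤ, IsLacunary Φ k := by
  set K := lacunaryLength Φ with hKdef
  have hK0 : K 0 = ⌈Φ 0 0⌉₊ + 1 := rfl
  have hK : ∀ m, K (m + 1) = max ⌈Φ (m + 1) (K m)⌉₊ (K m) + 1 := fun _ => rfl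
  let k : ℕ → Fin s → ℤ := fun m => Pi.single ⟨0, hs⟩ (K m : ℤ)
  have hnorm : ∀ m, freqNorm (k m) = K m := by
    intro m
    rw [freqNorm, Finset.sum_eq_single (⟨0, hs⟩ : Fin s)]
    · simp [k]
    · intro j _ hj
      simp [k, Pi.single_eq_of_ne hj]
    · simp
  have hlt : ∀ m, K m < K (m + 1) := fun m => by
    rw [hK]; exact Nat.lt_succ_of_le (le_max_right _ _)
  have hpos : ∀ m, 0 < K m := fun m => by
    cases m with
    | zero => rw [hK0]; exact Nat.succ_pos _
    | succ m => exact (Nat.zero_le _).trans_lt (hlt m)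
  refine ⟨k, fun m h => ?_, strictMono_nat_of_lt_succ fun m => ?_, ?_, fun m => ?_⟩
  · have := hnorm m
    rw [h] at this
    simp [freqNorm] at this
    exact (hpos m).ne (by exact_mod_cast this)
  · simp only [hnorm]
    exact_mod_cast hlt m
  · rw [hnorm, hK0]
    push_cast
    linarith [Nat.le_ceil (Φ 0 0)]
  · rw [hnorm, hnorm, hK]
    push_cast
    have := (Nat.le_ceil (Φ (m + 1) (K m))).trans (le_max_left _ (K m : ℝ))
    linarith

end Thresholds

/-- The explicit counterexamples: all sufficiently lacunary densities. -/
theorem exists_lacunary_threshold (n s : ℕ) (hs : 1 ≤ s) (hsn : s < n) (a : ℕ → ℝ)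
    (ha : ∀ m, 0 < a m) (hsum : Summable a) (h4 : ∑' m, a m ≤ 1 / 4) (δ : ℝ) (hδ : 0 < δ)
    (ψ : ℝ → ℝ) (hψ : Tendsto ψ (𝓝[>] 0) (𝓝 0)) :
    ∃ Φ : ℕ → ℝ → ℝ, ∀ k : ℕ → Fin s → ℤ, IsLacunary Φ k →
        ∃ A : ℝ, A = ∫ x, lacunaryDensity a k x ^ 2 ∂(circleVolume s) ∧
          A = 1 + (∑' m, a m ^ 2) / 2 ∧
          IsFiniteMeasure (lacunaryMeasure n a k) ∧
          IsAhlforsRegular (lacunaryMeasure n a k) (s : ℝ) ∧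
          HasAveragedDensity (lacunaryMeasure n a k) (s : ℝ) A ∧
          ¬ ((fun r : ℝ => normDistDistribution (lacunaryMeasure n a k) (s : ℝ) A r - 1)
              =O[𝓝[>] 0] ψ) ∧
          ¬ ((fun t : ℝ => gaussianAverage (lacunaryMeasure n a k) t / t ^ ((s : ℝ) / 2)
                - gammaConst (s : ℝ) * A) =O[𝓝[>] 0] fun t : ℝ => t ^ (δ / 2)) ∧
          ∀ (e : ℕ → FlatTorus n → ℝ) (lam : ℕ → ℝ), IsLaplaceEigenbasis n e lam →
            ¬ HasPowerSaving e lam (lacunaryMeasure n a k) (s : ℝ) A δ := by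
  obtain ⟨d, rfl⟩ := Nat.exists_eq_add_of_le hsn.le
  have hd : 1 ≤ d := by omega
  have had : IsAdmissible a := ⟨hsum, fun m => (ha m).le, h4⟩
  choose T hT using fun m => eventually_atTop.1 (eventually_isFarFrequency hs hd ha hδ hψ m)
  -- The thresholds can ignore the previous length, because `IsLacunary` already contains the strict
  -- growth of lengths.
  refine ⟨fun m _ => T m, fun k hk => ?_⟩
  obtain ⟨hk0, hmono, hΦ0, hΦ⟩ := hk
  have hfar : ∀ m, IsFarFrequency s d a δ ψ m (freqNorm (k m)) := fun m => by
    cases m with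
    | zero => exact hT 0 _ hΦ0
    | succ m => exact hT (m + 1) _ (hΦ m)
  refine ⟨lacunaryCorr a k 0, ?_, lacunaryCorr_zero, had.isFiniteMeasure_lacunaryMeasure,
    had.isAhlforsRegular hs hsn.le, had.hasAveragedDensity hs hsn.le hk0 hmono,
    lacunaryMeasure_slow hs ha had hk0 hmono hfar⟩
  rw [lacunaryCorr_zero, integral_sq_lacunaryDensity hsum had.nonneg hk0 hmono]

theorem mainTheorem3 :
    -- no uniform power saving on the flat torus `𝕋ⁿ`, for any integer `1 ≤ s < n`
    (∀ n s : ℕ, 1 ≤ s → s < n →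
      ∀ (e : ℕ → FlatTorus n → ℝ) (lam : ℕ → ℝ), IsLaplaceEigenbasis n e lam →
        ¬ ∃ δ : ℝ, 0 < δ ∧
          ∀ μ : Measure (FlatTorus n), IsFiniteMeasure μ → IsAhlforsRegular μ (s : ℝ) →
            ∀ A : ℝ, HasAveragedDensity μ (s : ℝ) A → HasPowerSaving e lam μ (s : ℝ) A δ) ∧
    -- the explicit counterexample: all sufficiently lacunary frequencies
    (∀ n s : ℕ, 1 ≤ s → s < n →
      ∀ a : ℕ → ℝ, (∀ m, 0 < a m) → Summable a → ∑' m, a m ≤ 1 / 4 →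
      ∀ δ : ℝ, 0 < δ → ∀ ψ : ℝ → ℝ, Tendsto ψ (𝓝[>] 0) (𝓝 0) →
      ∃ Φ : ℕ → ℝ → ℝ, ∀ k : ℕ → Fin s → ℤ, IsLacunary Φ k →
        ∃ A : ℝ, A = ∫ x, lacunaryDensity a k x ^ 2 ∂(circleVolume s) ∧
          A = 1 + (∑' m, a m ^ 2) / 2 ∧
          IsFiniteMeasure (lacunaryMeasure n a k) ∧
          IsAhlforsRegular (lacunaryMeasure n a k) (s : ℝ) ∧
          HasAveragedDensity (lacunaryMeasure n a k) (s : ℝ) A ∧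
          -- `q(r) → 1` slower than the prescribed rate `ψ`
          ¬ ((fun r : ℝ => normDistDistribution (lacunaryMeasure n a k) (s : ℝ) A r - 1)
              =O[𝓝[>] 0] ψ) ∧
          ¬ ((fun t : ℝ => gaussianAverage (lacunaryMeasure n a k) t / t ^ ((s : ℝ) / 2)
                - gammaConst (s : ℝ) * A) =O[𝓝[>] 0] fun t : ℝ => t ^ (δ / 2)) ∧
          ∀ (e : ℕ → FlatTorus n → ℝ) (lam : ℕ → ℝ), IsLaplaceEigenbasis n e lam →
            ¬ HasPowerSaving e lam (lacunaryMeasure n a k) (s : ℝ) A δ) ∧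
    -- a deviation of `q` from `1` on a block of scales is seen by the Gaussian average
    (∀ s : ℝ, 0 < s → ∃ c : ℝ, 0 < c ∧
      ∀ (M : Type u) [MetricSpace M] [CompactSpace M] [MeasurableSpace M] [BorelSpace M]
        (μ : Measure M) [IsFiniteMeasure μ] (A C₀ : ℝ), 0 < A → 1 ≤ C₀ →
        Tendsto (normDistDistribution μ s A) (𝓝[>] 0) (𝓝 1) →
        (∀ r : ℝ, 0 < r → r ≤ Metric.diam (Set.univ : Set M) →
          normDistDistribution μ s A r ≤ C₀) →
        ∀ η U : ℝ, 0 < η → η < 1 → 2 ≤ U →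
          ∫ u in Set.Ioi U, gaussWeight s u ≤ η / (8 * C₀) * ∫ u in (1 : ℝ)..U, gaussWeight s u →
          -- all sufficiently small scales `r`
          (∀ᶠ r : ℝ in 𝓝[>] 0,
            (∀ ρ ∈ Set.Icc r (U * r), normDistDistribution μ s A ρ ≤ 1 - η) →
              c * A * η * ∫ u in (1 : ℝ)..U, gaussWeight s u ≤
                |gaussianAverage μ (r ^ 2) / (r ^ 2) ^ (s / 2) - gammaConst s * A|) ∧
          -- every scale `r`, if `q ≤ 1` below it
          (∀ r : ℝ, 0 < r →
            (∀ ρ ∈ Set.Ioc 0 r, normDistDistribution μ s A ρ ≤ 1) →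
            (∀ ρ ∈ Set.Icc r (U * r), normDistDistribution μ s A ρ ≤ 1 - η) →
              c * A * η * ∫ u in (1 : ℝ)..U, gaussWeight s u ≤
                |gaussianAverage μ (r ^ 2) / (r ^ 2) ^ (s / 2) - gammaConst s * A|)) := by
  refine ⟨?_, exists_lacunary_threshold, gaussianAverage_deviation⟩
  rintro n s hs hsn e lam he ⟨δ, hδ, h⟩
  -- The ratio `1/2` and first term `1/8` use up the allowed total `1/4` exactly.
  have hgeo : HasSum (fun m : ℕ => (1 / 8 : ℝ) * (1 / 2) ^ m) (1 / 4) := by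
    have := hasSum_geometric_two.mul_left (1 / 8 : ℝ)
    norm_num at this ⊢
    exact this
  -- The rate for `q` plays no role here, so `ψ = id` is an arbitrary choice.
  obtain ⟨Φ, hΦ⟩ := exists_lacunary_threshold n s hs hsn (fun m => 1 / 8 * (1 / 2) ^ m)
    (fun m => by positivity) hgeo.summable hgeo.tsum_eq.le δ hδ id
    (tendsto_id.mono_left nhdsWithin_le_nhds)
  obtain ⟨k, hk⟩ := exists_isLacunary hs Φ
  obtain ⟨A, -, -, hfin, hreg, hdens, -, -, hN⟩ := hΦ k hk
  exact hN e lam he (h _ hfin hreg A hdens)
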